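/- Let $(X,\mathcal B,m)$ be a $\sigma$-finite measure space with $m(X)=\infty$ and let $T:X\to X$ be an invertible (bimeasurable), conservative, ergodic, measure preserving transformation. Put $S_n(f)=\sum_{k=0}^{n-1}f\circ T^k$ and $\Sigma_n(f)=\sum_{|k|<n}f\circ T^k$ (with $k\in\mathbb Z$), and for $A\in\mathcal B$ with $0<m(A)<\infty$ put $a_n(A)=\sum_{k=0}^{n-1}m(A\cap T^{-k}A)/m(A)^2$. Suppose that $T$ is boundedly rationally ergodic, that is, there are a set $A\in\mathcal B$ with $0<m(A)<\infty$ and a constant $M<\infty$ such that $S_n(1_A)\le M a_n(A)$ a.e. on $A$ for all $n\ge1$; for any such set $A$ write $a_n(T):=a_n(A)$. Let $L^1_+$ denote the set of nonnegative integrable functions. Then there are unique constants $\underline\beta(T)\in[0,1]$ and $\overline\beta(T)\in[1,\infty)$ such that, for every admissible choice of $A$ and every $f\in L^1_+$, almost everywhere $$\varliminf_{n\to\infty}\frac{\Sigma_n(f)}{2a_n(T)}=\underline\beta(T)\int_X f\,dm,\qquad \varlimsup_{n\to\infty}\frac{\Sigma_n(f)}{2a_n(T)}=\overline\beta(T)\int_X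 f\,dm .$$ Moreover, for every real sequence $a_n\to\infty$ and every $f\in L^1_+$, for almost every $x$ with $0<\varliminf_{n\to\infty}\Sigma_n(f)(x)/a_n<\infty$ one has $$\frac{\varliminf_{n\to\infty}\Sigma_n(f)(x)/a_n}{\varlimsup_{n\to\infty}\Sigma_n(f)(x)/a_n}\le\sqrt{\frac{\underline\beta(T)}{\overline\beta(T)}}$$ (with the convention $c/\infty=0$ for $0\le c<\infty$); and if in addition $\varlimsup_{n\to\infty}\Sigma_n(f)(x)/a_n<\infty$, then $a_n\asymp 2a_n(T)$, that is, there is $C>1$ with $C^{-1}a_n\le 2a_n(T)\le Ca_n$ for all large $n$. -/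

import Mathlib

open MeasureTheory Filter Asymptotics
open scoped Topology

noncomputable section

/-- The symmetric (two-sided) Birkhoff sum `Σ_n(f)(x) = ∑_{|k| < n} f (T^k x)`, where `k` runs over
the integers and `T` is invertible. -/
def symmSum {X : Type*} [MeasurableSpace X] (T : X ≃ᵐ X) (f : X → ℝ) (n : ℕ) (x : X) : ℝ :=
  ∑ k ∈ Finset.Ioo (-(n : ℤ)) (n : ℤ), f ((T.toEquiv ^ k : Equiv.Perm X) x)

/-- `a_n(A) = ∑_{k=0}^{n-1} μ(A ∩ T^{-k} A) / μ(A)^2`. -/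
def returnSeq {X : Type*} [MeasurableSpace X] (μ : Measure X) (T : X ≃ᵐ X) (A : Set X)
    (n : ℕ) : ℝ :=
  ∑ k ∈ Finset.range n, μ.real (A ∩ (T^[k]) ⁻¹' A) / (μ.real A) ^ 2

/-- `A` witnesses bounded rational ergodicity: `A` is measurable, `0 < μ(A) < ∞`, and for some
finite `M` one has `S_n(1_A) ≤ M a_n(A)` a.e. on `A` for all `n ≥ 1`, where
`S_n(g) = ∑_{k=0}^{n-1} g ∘ T^k` is the one-sided Birkhoff sum. -/
def IsBRESet {X : Type*} [MeasurableSpace X] (μ : Measure X) (T : X ≃ᵐ X) (A : Set X) : Prop :=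
  MeasurableSet A ∧ 0 < μ A ∧ μ A < ⊤ ∧
    ∃ M : ℝ, ∀ n : ℕ, 1 ≤ n → ∀ᵐ x ∂(μ.restrict A),
      birkhoffSum T (A.indicator (fun _ => (1 : ℝ))) n x ≤ M * returnSeq μ T A n

/-- `T` is boundedly rationally ergodic: it is a conservative, ergodic, measure preserving
transformation for which a set as in `IsBRESet` exists. -/
def BoundedlyRationallyErgodic {X : Type*} [MeasurableSpace X] (μ : Measure X)
    (T : X ≃ᵐ X) : Prop :=
  Conservative T μ ∧ Ergodic T μ ∧ ∃ A : Set X, IsBRESet μ T A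

/-- `liminf_n Σ_n(f)(x) / a_n` in the extended reals. -/
def lowerRate {X : Type*} [MeasurableSpace X] (T : X ≃ᵐ X) (a : ℕ → ℝ) (f : X → ℝ)
    (x : X) : EReal :=
  liminf (fun n : ℕ => ((symmSum T f n x / a n : ℝ) : EReal)) atTop

/-- `limsup_n Σ_n(f)(x) / a_n` in the extended reals. -/
def upperRate {X : Type*} [MeasurableSpace X] (T : X ≃ᵐ X) (a : ℕ → ℝ) (f : X → ℝ)
    (x : X) : EReal :=
  limsup (fun n : ℕ => ((symmSum T f n x / a n : ℝ) : EReal)) atTop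

/-- The property defining the lower constant: `liminf Σ_n(f) / (2 a_n(T)) = β ∫ f` a.e. for every
nonnegative integrable `f`. The return sequence `a_n(T)` is `a_n(A)` for an arbitrary set `A` that
witnesses bounded rational ergodicity. -/
def IsLowerBeta {X : Type*} [MeasurableSpace X] (μ : Measure X) (T : X ≃ᵐ X) (β : ℝ) : Prop :=
  ∀ A : Set X, IsBRESet μ T A → ∀ f : X → ℝ, Integrable f μ → 0 ≤ᵐ[μ] f →
    ∀ᵐ x ∂μ, lowerRate T (fun n => 2 * returnSeq μ T A n) f x = ((β * ∫ y, f y ∂μ : ℝ) : EReal)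

/-- The property defining the upper constant: `limsup Σ_n(f) / (2 a_n(T)) = β ∫ f` a.e. for every
nonnegative integrable `f`. -/
def IsUpperBeta {X : Type*} [MeasurableSpace X] (μ : Measure X) (T : X ≃ᵐ X) (β : ℝ) : Prop :=
  ∀ A : Set X, IsBRESet μ T A → ∀ f : X → ℝ, Integrable f μ → 0 ≤ᵐ[μ] f →
    ∀ᵐ x ∂μ, upperRate T (fun n => 2 * returnSeq μ T A n) f x = ((β * ∫ y, f y ∂μ : ℝ) : EReal)

/-- The lower constant of `T`: the number with the property `IsLowerBeta` (it is determined by that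
property as soon as a set as in `IsBRESet` exists). -/
def lowerBeta {X : Type*} [MeasurableSpace X] (μ : Measure X) (T : X ≃ᵐ X) : ℝ :=
  Classical.epsilon (IsLowerBeta μ T)

/-- The upper constant of `T`: the number with the property `IsUpperBeta` (it is determined by that
property as soon as a set as in `IsBRESet` exists). -/
def upperBeta {X : Type*} [MeasurableSpace X] (μ : Measure X) (T : X ≃ᵐ X) : ℝ :=
  Classical.epsilon (IsUpperBeta μ T)

end

/-! Write `s n` for the symmetric sum of `1_A`, `d n` for `2 a_n(A)` and `α` for `μ(A)`, with `A` a
set witnessing bounded rational ergodicity. Three facts carry the proof.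

Ratio theorem (`ae_tendsto_symmSum_div`): `Σ_n(f) / s n → (∫ f) / α` a.e. for integrable `f`. The
maximal ergodic inequality and ergodicity bound the sums of a function of negative integral from
above, forwards and backwards; this is applied to `f - q 1_A` and `q 1_A - f`. Everything thus
reduces to `s n`, whose rates are a.e. constant because `s n (T x) - s n x` is bounded while `s n →
∞`.

Averages (`IsBRESet.tendsto_setIntegral_symmSum_div`): `s n / d n` is uniformly bounded a.e., and
its integral over `A` tends to `α ^ 2`. Hence a numerical sequence lying a.e. eventually below `s n
/ d n` has limsup at most `α`, and one lying above has liminf at least `α`. Constant sequences give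
`b ≤ α ≤ B` for the liminf `b` and limsup `B` of `s n / d n`; the constants of `T` are `b / α` and
`B / α`. They do not depend on `A`, because return sequences of two such sets are asymptotic
(`IsBRESet.tendsto_returnSeq_div`).

Arbitrary normalization (`IsBRESet.rates_le_and_isTheta`): if `s n / a n` has liminf `c > 0` and
finite limsup `C`, then `s n / d n` lies asymptotically between `c a n / d n` and `C a n / d n`.
These bounds are numerical, so `a n / d n` lies asymptotically in `[α / C, α / c]`. Reinserting this
gives `b ≥ c α / C` and `B ≤ C α / c`, whence `(c / C) ^ 2 ≤ b / B`. -/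

/-! ### Maximal inequality and one-sided Birkhoff sums -/

section Maximal

variable {X : Type*}

/-- The running maximum `max_{0 ≤ n ≤ N} S_n(h)` of the Birkhoff sums. -/
def birkhoffMax (T : X → X) (h : X → ℝ) : ℕ → X → ℝ
  | 0 => fun _ => 0
  | N + 1 => fun x => max 0 (h x + birkhoffMax T h N (T x))

theorem birkhoffMax_nonneg (T : X → X) (h : X → ℝ) (N : ℕ) (x : X) : 0 ≤ birkhoffMax T h N x := by
  cases N with
  | zero => exact le_rfl
  | succ N => exact le_max_left _ _

theorem birkhoffMax_mono_succ (T : X → X) (h : X → ℝ) (N : ℕ) (x : X) :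
    birkhoffMax T h N x ≤ birkhoffMax T h (N + 1) x := by
  induction N generalizing x with
  | zero => exact le_max_left _ _
  | succ N ih => exact max_le_max le_rfl (by linarith [ih (T x)])

theorem birkhoffSum_le_birkhoffMax (T : X → X) (h : X → ℝ) (N : ℕ) (x : X) :
    birkhoffSum T h N x ≤ birkhoffMax T h N x := by
  induction N generalizing x with
  | zero => simp [birkhoffMax]
  | succ N ih =>
    rw [birkhoffSum_succ']
    exact le_max_of_le_right (by linarith [ih (T x)])

variable [MeasurableSpace X] {μ : Measure X}

theorem measurable_birkhoffMax {T : X → X} (hT : Measurable T) {h : X → ℝ} (hh : Measurable h)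
    (N : ℕ) : Measurable (birkhoffMax T h N) := by
  induction N with
  | zero => exact measurable_const
  | succ N ih => exact measurable_const.max (hh.add (ih.comp hT))

theorem integrable_birkhoffMax {T : X → X} (hT : MeasurePreserving T μ μ) {h : X → ℝ}
    (hi : Integrable h μ) (N : ℕ) : Integrable (birkhoffMax T h N) μ := by
  induction N with
  | zero => exact integrable_zero _ _ _
  | succ N ih => exact (integrable_zero X ℝ μ).sup (hi.add (hT.integrable_comp_of_integrable ih))

/-- The finite form of the maximal ergodic inequality. -/
theorem setIntegral_birkhoffMax_pos_nonneg {T : X → X} (hT : MeasurePreserving T μ μ)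
    {h : X → ℝ} (hh : Measurable h) (hi : Integrable h μ) (N : ℕ) :
    0 ≤ ∫ x in {x | 0 < birkhoffMax T h N x}, h x ∂μ := by
  cases N with
  | zero => simp [birkhoffMax]
  | succ N =>
    set E := {x | 0 < birkhoffMax T h (N + 1) x}
    have hE : MeasurableSet E :=
      measurableSet_lt measurable_const (measurable_birkhoffMax hT.measurable hh _)
    have hM := integrable_birkhoffMax hT hi N
    have hMT := hT.integrable_comp_of_integrable hM
    -- On `E` the maximum is its second argument, and off `E` it vanishes. Therefore `∫_E h = ∫
    -- M_{N+1} - ∫_E M_N ∘ T ≥ ∫ M_{N+1} - ∫ M_N ≥ 0`, by nonnegativity, invariance of the measure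
    -- and monotonicity in `N`.
    have h1 : ∫ x, birkhoffMax T h (N + 1) x ∂μ = ∫ x in E, (h x + birkhoffMax T h N (T x)) ∂μ := by
      rw [← integral_indicator hE]
      congr 1 with x
      by_cases hx : x ∈ E
      · rw [Set.indicator_of_mem hx]
        rcases lt_max_iff.1 (show 0 < max 0 (h x + birkhoffMax T h N (T x)) from hx) with h' | h'
        · exact absurd h' (lt_irrefl _)
        · exact max_eq_right h'.le
      · rw [Set.indicator_of_notMem hx]
        exact le_antisymm (not_lt.1 hx) (birkhoffMax_nonneg T h (N + 1) x)
    have h2 : ∫ x in E, (h x + birkhoffMax T h N (T x)) ∂μ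
        = ∫ x in E, h x ∂μ + ∫ x in E, birkhoffMax T h N (T x) ∂μ :=
      integral_add hi.integrableOn hMT.integrableOn
    have h3 : ∫ x in E, birkhoffMax T h N (T x) ∂μ ≤ ∫ x, birkhoffMax T h N (T x) ∂μ :=
      setIntegral_le_integral hMT (ae_of_all _ fun x => birkhoffMax_nonneg T h N (T x))
    have h4 : ∫ x, birkhoffMax T h N (T x) ∂μ = ∫ x, birkhoffMax T h N x ∂μ := by
      have := integral_map (μ := μ) hT.measurable.aemeasurable (f := birkhoffMax T h N)
        (by rw [hT.map_eq]; exact hM.aestronglyMeasurable)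
      rw [hT.map_eq] at this
      exact this.symm
    have h5 : ∫ x, birkhoffMax T h N x ∂μ ≤ ∫ x, birkhoffMax T h (N + 1) x ∂μ :=
      integral_mono hM (integrable_birkhoffMax hT hi (N + 1)) (birkhoffMax_mono_succ T h N)
    linarith

/-- The maximal ergodic theorem, when almost every point has a positive Birkhoff sum. -/
theorem integral_nonneg_of_ae_exists_birkhoffSum_pos {T : X → X} (hT : MeasurePreserving T μ μ)
    {h : X → ℝ} (hh : Measurable h) (hi : Integrable h μ)
    (hpos : ∀ᵐ x ∂μ, ∃ n, 0 < birkhoffSum T h n x) : 0 ≤ ∫ x, h x ∂μ := by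
  have hlim := tendsto_setIntegral_of_monotone (μ := μ) (f := h)
    (s := fun N => {x | 0 < birkhoffMax T h N x})
    (fun N => measurableSet_lt measurable_const (measurable_birkhoffMax hT.measurable hh _))
    (monotone_nat_of_le_succ fun N x hx => lt_of_lt_of_le hx (birkhoffMax_mono_succ T h N x))
    hi.integrableOn
  have hu : (⋃ N, {x | 0 < birkhoffMax T h N x}) =ᵐ[μ] Set.univ := by
    rw [eventuallyEq_univ]
    filter_upwards [hpos] with x ⟨n, hn⟩
    exact Set.mem_iUnion.2 ⟨n, lt_of_lt_of_le hn (birkhoffSum_le_birkhoffMax T h n x)⟩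
  rw [setIntegral_congr_set hu, setIntegral_univ] at hlim
  exact ge_of_tendsto' hlim fun N => setIntegral_birkhoffMax_pos_nonneg hT hh hi N

theorem measurable_birkhoffSum {T : X → X} (hT : Measurable T) {h : X → ℝ} (hh : Measurable h)
    (n : ℕ) : Measurable (birkhoffSum T h n) :=
  Finset.measurable_fun_sum _ fun k _ => hh.comp (hT.iterate k)

/-- Birkhoff sums of an integrable function of negative integral are a.e. bounded above. -/
theorem ae_birkhoffSum_le_of_integral_neg {T : X → X} (hT : Ergodic T μ) {h : X → ℝ}
    (hh : Measurable h) (hi : Integrable h μ) (hneg : ∫ x, h x ∂μ < 0) :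
    ∀ᵐ x ∂μ, ∃ K : ℝ, ∀ n, birkhoffSum T h n x ≤ K := by
  set B : Set X := {x | ∀ K : ℕ, ∃ n, (K : ℝ) < birkhoffSum T h n x} with hB
  have hBm : MeasurableSet B := by
    have : B = ⋂ K : ℕ, ⋃ n, {x | (K : ℝ) < birkhoffSum T h n x} := by
      ext x; simp [hB]
    rw [this]
    exact MeasurableSet.iInter fun K => MeasurableSet.iUnion fun n =>
      measurableSet_lt measurable_const (measurable_birkhoffSum hT.measurable hh n)
  -- Since `S_{n+1}(x) = h(x) + S_n(T x)`, moving along the orbit only shifts the threshold by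
  -- `h(x)`, which does not affect unboundedness.
  have hBi : T ⁻¹' B = B := by
    ext x
    constructor
    · intro hx K
      obtain ⟨K', hK'⟩ := exists_nat_ge ((K : ℝ) - h x)
      obtain ⟨n, hn⟩ := hx K'
      exact ⟨n + 1, by rw [birkhoffSum_succ']; linarith⟩
    · intro hx K
      obtain ⟨K', hK'⟩ := exists_nat_ge ((K : ℝ) + h x)
      obtain ⟨n, hn⟩ := hx K'
      cases n with
      | zero =>
        simp only [birkhoffSum_zero] at hn
        exact absurd hn (not_lt.2 (Nat.cast_nonneg _))
      | succ m => exact ⟨m, by rw [birkhoffSum_succ'] at hn; linarith⟩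
  rcases hT.toPreErgodic.ae_mem_or_ae_notMem hBm hBi with h1 | h1
  · refine absurd (integral_nonneg_of_ae_exists_birkhoffSum_pos hT.toMeasurePreserving hh hi ?_)
      (not_le.2 hneg)
    filter_upwards [h1] with x hx
    obtain ⟨n, hn⟩ := hx 0
    exact ⟨n, by simpa using hn⟩
  · filter_upwards [h1] with x hx
    simp only [hB, Set.mem_ofPred_eq, not_forall, not_exists, not_lt] at hx
    obtain ⟨K, hK⟩ := hx
    exact ⟨K, hK⟩

/-- In a conservative ergodic system the occupation times of a set of positive measure tend to
infinity. -/
theorem ae_tendsto_birkhoffSum_indicator_atTop {T : X → X} (hc : Conservative T μ)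
    (hT : Ergodic T μ) {A : Set X} (hA : MeasurableSet A) (hpos : 0 < μ A) :
    ∀ᵐ x ∂μ, Tendsto (fun n => birkhoffSum T (A.indicator (fun _ => (1 : ℝ))) n x) atTop atTop := by
  set p : X → ℝ := A.indicator (fun _ => (1 : ℝ))
  have hp0 : ∀ y, 0 ≤ p y := fun y => Set.indicator_nonneg (fun _ _ => zero_le_one) y
  set B : Set X := {x | ∃ᶠ n in atTop, T^[n] x ∈ A} with hB
  have hBm : MeasurableSet B := by
    have : B = ⋂ N : ℕ, ⋃ n : ℕ, ⋃ _ : N ≤ n, T^[n] ⁻¹' A := by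
      ext x; simp [hB, frequently_atTop]
    rw [this]
    exact MeasurableSet.iInter fun N => MeasurableSet.iUnion fun n => MeasurableSet.iUnion fun _ =>
      (hT.measurable.iterate n) hA
  have hBi : T ⁻¹' B = B := by
    ext x
    have := Filter.frequently_map (f := atTop) (m := fun n : ℕ => n + 1) (P := fun n => T^[n] x ∈ A)
    rw [map_add_atTop_eq_nat] at this
    simp only [hB, Set.mem_preimage, Set.mem_ofPred_eq, this, Function.iterate_succ_apply]
  have hfull : ∀ᵐ x ∂μ, x ∈ B := by
    -- By recurrence almost every point of `A` lies in `B`, so `B` null would make `A` null.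
    refine (hT.toPreErgodic.ae_mem_or_ae_notMem hBm hBi).resolve_right fun h => ?_
    have : ∀ᵐ x ∂μ, x ∉ A := by
      filter_upwards [h, hc.ae_mem_imp_frequently_image_mem hA.nullMeasurableSet] with x h1 h2 h3
      exact h1 (h2 h3)
    rw [ae_iff] at this
    simp only [not_not, Set.ofPred_mem_eq] at this
    exact hpos.ne' this
  filter_upwards [hfull] with x hx
  have hmono : Monotone fun n => birkhoffSum T p n x := monotone_nat_of_le_succ fun n => by
    rw [birkhoffSum_succ]; linarith [hp0 (T^[n] x)]
  refine tendsto_atTop_atTop_of_monotone hmono fun b => ?_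
  have key : ∀ K : ℕ, ∃ n, (K : ℝ) ≤ birkhoffSum T p n x := by
    intro K
    induction K with
    | zero => exact ⟨0, by simp⟩
    | succ K ih =>
      obtain ⟨n, hn⟩ := ih
      obtain ⟨m, hm, hmA⟩ := (frequently_atTop.1 hx) n
      refine ⟨m + 1, ?_⟩
      have h1 := hmono hm
      have h2 : p (T^[m] x) = 1 := Set.indicator_of_mem hmA _
      rw [birkhoffSum_succ, h2]
      push_cast
      simp only at h1
      linarith
  obtain ⟨K, hK⟩ := exists_nat_ge b
  obtain ⟨n, hn⟩ := key K
  exact ⟨n, hK.trans hn⟩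

theorem Conservative.symm {T : X ≃ᵐ X} (hc : Conservative T μ) (hT : MeasurePreserving T μ μ) :
    Conservative T.symm μ where
  toQuasiMeasurePreserving := (hT.symm T).quasiMeasurePreserving
  exists_mem_iterate_mem' s hs h0 := by
    obtain ⟨x, hx, m, hm, hmx⟩ := hc.exists_mem_iterate_mem' hs h0
    refine ⟨T^[m] x, hmx, m, hm, ?_⟩
    rwa [Function.LeftInverse.iterate T.symm_apply_apply m x]

end Maximal

/-! ### Symmetric sums and their ratio theorem -/

section SymmSum

variable {X : Type*} [MeasurableSpace X] {μ : Measure X}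

theorem zpow_natCast_apply (T : X ≃ᵐ X) (n : ℕ) (x : X) :
    (T.toEquiv ^ (n : ℤ) : Equiv.Perm X) x = T^[n] x := by
  rw [zpow_natCast, Equiv.Perm.coe_pow]; rfl

theorem zpow_neg_natCast_apply (T : X ≃ᵐ X) (n : ℕ) (x : X) :
    (T.toEquiv ^ (-(n : ℤ)) : Equiv.Perm X) x = T.symm^[n] x := by
  rw [zpow_neg, zpow_natCast, ← inv_pow, Equiv.Perm.coe_pow]; rfl

theorem measurePreserving_zpow {T : X ≃ᵐ X} (hT : MeasurePreserving T μ μ) (k : ℤ) :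
    MeasurePreserving (T.toEquiv ^ k : Equiv.Perm X) μ μ := by
  obtain ⟨n, rfl | rfl⟩ := k.eq_nat_or_neg
  · rw [show ⇑(T.toEquiv ^ (n : ℤ) : Equiv.Perm X) = T^[n] from funext (zpow_natCast_apply T n)]
    exact hT.iterate n
  · rw [show ⇑(T.toEquiv ^ (-(n : ℤ)) : Equiv.Perm X) = T.symm^[n] from
      funext (zpow_neg_natCast_apply T n)]
    exact (hT.symm T).iterate n

theorem Ioo_neg_succ_eq_insert {n : ℕ} (hn : 1 ≤ n) :
    Finset.Ioo (-((n + 1 : ℕ) : ℤ)) ((n + 1 : ℕ) : ℤ)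
      = insert (n : ℤ) (insert (-(n : ℤ)) (Finset.Ioo (-(n : ℤ)) (n : ℤ))) := by
  ext k
  simp only [Finset.mem_Ioo, Finset.mem_insert]
  push_cast
  omega

theorem symmSum_one (T : X ≃ᵐ X) (f : X → ℝ) (x : X) : symmSum T f 1 x = f x := by
  have : Finset.Ioo (-((1 : ℕ) : ℤ)) ((1 : ℕ) : ℤ) = {0} := by decide
  rw [symmSum, this]; simp

theorem symmSum_succ (T : X ≃ᵐ X) (f : X → ℝ) {n : ℕ} (hn : 1 ≤ n) (x : X) :
    symmSum T f (n + 1) x = symmSum T f n x + f (T^[n] x) + f (T.symm^[n] x) := by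
  rw [symmSum, Ioo_neg_succ_eq_insert hn, Finset.sum_insert, Finset.sum_insert, zpow_natCast_apply,
    zpow_neg_natCast_apply, ← symmSum]
  · ring
  · simp
  · simp only [Finset.mem_insert, Finset.mem_Ioo]; omega

/-- The term `k = 0` occurs in both one-sided sums and is removed once. At `n = 0` the left side is
empty and the formula would leave `-f x`. -/
theorem symmSum_eq (T : X ≃ᵐ X) (f : X → ℝ) {n : ℕ} (hn : 1 ≤ n) (x : X) :
    symmSum T f n x = birkhoffSum T f n x + birkhoffSum T.symm f n x - f x := by
  induction n, hn using Nat.le_induction with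
  | base => simp [symmSum_one]
  | succ n hn ih =>
    rw [symmSum_succ T f hn, ih, birkhoffSum_succ, birkhoffSum_succ]
    ring

theorem symmSum_nonneg (T : X ≃ᵐ X) {f : X → ℝ} (hf : ∀ x, 0 ≤ f x) (n : ℕ) (x : X) :
    0 ≤ symmSum T f n x :=
  Finset.sum_nonneg fun _ _ => hf _

theorem symmSum_mul_add_mul (T : X ≃ᵐ X) (f g : X → ℝ) (a b : ℝ) (n : ℕ) (x : X) :
    symmSum T (fun y => a * f y + b * g y) n x = a * symmSum T f n x + b * symmSum T g n x := by
  simp only [symmSum, Finset.sum_add_distrib, Finset.mul_sum]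

theorem measurable_symmSum {T : X ≃ᵐ X} (hT : MeasurePreserving T μ μ) {f : X → ℝ}
    (hf : Measurable f) (n : ℕ) : Measurable (symmSum T f n) :=
  Finset.measurable_fun_sum _ fun k _ => hf.comp (measurePreserving_zpow hT k).measurable

theorem integrable_symmSum {T : X ≃ᵐ X} (hT : MeasurePreserving T μ μ) {f : X → ℝ}
    (hf : Integrable f μ) (n : ℕ) : Integrable (symmSum T f n) μ :=
  integrable_finsetSum _ fun k _ =>
    (measurePreserving_zpow hT k).integrable_comp_of_integrable hf

/-- Only countably many powers of `T` occur, so one null set serves all `n`. -/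
theorem symmSum_ae_eq {T : X ≃ᵐ X} (hT : MeasurePreserving T μ μ) {f g : X → ℝ}
    (hfg : f =ᵐ[μ] g) : ∀ᵐ x ∂μ, ∀ n, symmSum T f n x = symmSum T g n x := by
  have : ∀ᵐ x ∂μ, ∀ k : ℤ, f ((T.toEquiv ^ k : Equiv.Perm X) x)
      = g ((T.toEquiv ^ k : Equiv.Perm X) x) :=
    ae_all_iff.2 fun k => (measurePreserving_zpow hT k).quasiMeasurePreserving.ae hfg
  filter_upwards [this] with x hx n
  exact Finset.sum_congr rfl fun k _ => hx k

/-- Shifting the base point changes the symmetric sum of an indicator by a bounded amount. -/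
theorem abs_symmSum_indicator_apply_sub_le (T : X ≃ᵐ X) (A : Set X) (n : ℕ) (x : X) :
    |symmSum T (A.indicator (fun _ => (1 : ℝ))) n (T x)
      - symmSum T (A.indicator (fun _ => (1 : ℝ))) n x| ≤ 3 := by
  set p : X → ℝ := A.indicator (fun _ => (1 : ℝ))
  have hp0 : ∀ y, 0 ≤ p y := fun y => Set.indicator_nonneg (fun _ _ => zero_le_one) y
  have hp1 : ∀ y, p y ≤ 1 := fun y => Set.indicator_le_self' (fun _ _ => zero_le_one) y
  rcases Nat.eq_zero_or_pos n with rfl | hn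
  · simp [symmSum]
  · have h1 := birkhoffSum_apply_sub_birkhoffSum T p n x
    have h2 := birkhoffSum_apply_sub_birkhoffSum T.symm p n (T x)
    rw [T.symm_apply_apply] at h2
    rw [symmSum_eq T p hn, symmSum_eq T p hn, abs_le]
    constructor <;>
    linarith [hp0 (T^[n] x), hp0 x, hp0 (T x), hp0 (T.symm^[n] (T x)),
      hp1 (T^[n] x), hp1 x, hp1 (T x), hp1 (T.symm^[n] (T x))]

/-- Symmetric sums of an integrable function of negative integral are a.e. bounded above. -/
theorem ae_symmSum_le_of_integral_neg {T : X ≃ᵐ X} (hT : Ergodic T μ) {h : X → ℝ}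
    (hh : Measurable h) (hi : Integrable h μ) (hneg : ∫ x, h x ∂μ < 0) :
    ∀ᵐ x ∂μ, ∃ K : ℝ, ∀ n, symmSum T h n x ≤ K := by
  filter_upwards [ae_birkhoffSum_le_of_integral_neg hT hh hi hneg,
    ae_birkhoffSum_le_of_integral_neg hT.symm hh hi hneg] with x ⟨K, hK⟩ ⟨K', hK'⟩
  refine ⟨max 0 (K + K' - h x), fun n => ?_⟩
  rcases Nat.eq_zero_or_pos n with rfl | hn
  · simp [symmSum]
  · rw [symmSum_eq T h hn]
    exact le_max_of_le_right (by linarith [hK n, hK' n])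

theorem ae_tendsto_symmSum_indicator_atTop {T : X ≃ᵐ X} (hc : Conservative T μ)
    (hT : Ergodic T μ) {A : Set X} (hA : MeasurableSet A) (hpos : 0 < μ A) :
    ∀ᵐ x ∂μ, Tendsto (fun n => symmSum T (A.indicator (fun _ => (1 : ℝ))) n x) atTop atTop := by
  filter_upwards [ae_tendsto_birkhoffSum_indicator_atTop hc hT hA hpos] with x hx
  set p : X → ℝ := A.indicator (fun _ => (1 : ℝ))
  have hp0 : ∀ y, 0 ≤ p y := fun y => Set.indicator_nonneg (fun _ _ => zero_le_one) y
  have hp1 : ∀ y, p y ≤ 1 := fun y => Set.indicator_le_self' (fun _ _ => zero_le_one) y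
  refine tendsto_atTop_mono' _ ?_ (tendsto_atTop_add_const_right _ (-1) hx)
  filter_upwards [eventually_ge_atTop 1] with n hn
  have : 0 ≤ birkhoffSum T.symm p n x := Finset.sum_nonneg fun _ _ => hp0 _
  rw [symmSum_eq T p hn]
  linarith [hp1 x]

/-- The ratio ergodic theorem for symmetric sums, for a measurable integrable function against
the indicator of a set of finite positive measure. -/
theorem ae_tendsto_symmSum_div_of_measurable {T : X ≃ᵐ X} (hc : Conservative T μ)
    (hT : Ergodic T μ) {A : Set X} (hA : MeasurableSet A) (hpos : 0 < μ A) (hfin : μ A < ⊤)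
    {f : X → ℝ} (hf : Measurable f) (hi : Integrable f μ) :
    ∀ᵐ x ∂μ, Tendsto
      (fun n => symmSum T f n x / symmSum T (A.indicator (fun _ => (1 : ℝ))) n x)
      atTop (𝓝 ((∫ y, f y ∂μ) / μ.real A)) := by
  set p : X → ℝ := A.indicator (fun _ => (1 : ℝ))
  have hpm : Measurable p := measurable_const.indicator hA
  have hpi : Integrable p μ := (integrable_indicator_iff hA).2 (integrableOn_const hfin.ne)
  have hpint : ∫ y, p y ∂μ = μ.real A := integral_indicator_one hA
  have hα : 0 < μ.real A := ENNReal.toReal_pos hpos.ne' hfin.ne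
  -- Rational slopes keep the exceptional sets countable in number. The function `f - q 1_A` has
  -- negative integral exactly when `q` exceeds the expected limit.
  have hup : ∀ q : ℚ, (∫ y, f y ∂μ) / μ.real A < q →
      ∀ᵐ x ∂μ, ∃ K : ℝ, ∀ n, symmSum T f n x - q * symmSum T p n x ≤ K := by
    intro q hq
    have := ae_symmSum_le_of_integral_neg hT
      ((hf.const_mul 1).add (hpm.const_mul (-(q : ℝ)))) ((hi.const_mul 1).add (hpi.const_mul _)) (by
        simp only [Pi.add_apply]
        rw [integral_add (hi.const_mul 1) (hpi.const_mul _), integral_const_mul,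
          integral_const_mul, hpint]
        rw [div_lt_iff₀ hα] at hq
        linarith)
    filter_upwards [this] with x ⟨K, hK⟩
    refine ⟨K, fun n => ?_⟩
    have h1 := hK n
    have h2 := symmSum_mul_add_mul T f p 1 (-(q : ℝ)) n x
    have h3 : symmSum T (fun y => 1 * f y + -(q : ℝ) * p y) n x ≤ K := h1
    linarith
  have hlo : ∀ q : ℚ, (q : ℝ) < (∫ y, f y ∂μ) / μ.real A →
      ∀ᵐ x ∂μ, ∃ K : ℝ, ∀ n, q * symmSum T p n x - symmSum T f n x ≤ K := by
    intro q hq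
    have := ae_symmSum_le_of_integral_neg hT
      ((hf.const_mul (-1)).add (hpm.const_mul (q : ℝ)))
      ((hi.const_mul (-1)).add (hpi.const_mul _)) (by
        simp only [Pi.add_apply]
        rw [integral_add (hi.const_mul (-1)) (hpi.const_mul _), integral_const_mul,
          integral_const_mul, hpint]
        rw [lt_div_iff₀ hα] at hq
        linarith)
    filter_upwards [this] with x ⟨K, hK⟩
    refine ⟨K, fun n => ?_⟩
    have h1 := hK n
    have h2 := symmSum_mul_add_mul T f p (-1) (q : ℝ) n x
    have h3 : symmSum T (fun y => -1 * f y + (q : ℝ) * p y) n x ≤ K := h1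
    linarith
  have hup' := ae_all_iff.2 fun q => eventually_imp_distrib_left.2 (hup q)
  have hlo' := ae_all_iff.2 fun q => eventually_imp_distrib_left.2 (hlo q)
  filter_upwards [hup', hlo', ae_tendsto_symmSum_indicator_atTop hc hT hA hpos] with x h1 h2 h3
  rw [tendsto_order]
  constructor
  · intro a ha
    obtain ⟨q, hq1, hq2⟩ := exists_rat_btwn ha
    obtain ⟨K, hK⟩ := h2 q hq2
    -- The bounded error `K` is absorbed by the gap between `a` and `q` times the divergent sum of
    -- `1_A`.
    have h4 : Tendsto (fun n => ((q : ℝ) - a) * symmSum T p n x) atTop atTop :=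
      h3.const_mul_atTop (by linarith)
    filter_upwards [h3.eventually_gt_atTop 0, h4.eventually_gt_atTop K] with n hn1 hn2
    rw [lt_div_iff₀ hn1]
    linarith [hK n]
  · intro a ha
    obtain ⟨q, hq1, hq2⟩ := exists_rat_btwn ha
    obtain ⟨K, hK⟩ := h1 q hq1
    have h4 : Tendsto (fun n => (a - (q : ℝ)) * symmSum T p n x) atTop atTop :=
      h3.const_mul_atTop (by linarith)
    filter_upwards [h3.eventually_gt_atTop 0, h4.eventually_gt_atTop K] with n hn1 hn2
    rw [div_lt_iff₀ hn1]
    linarith [hK n]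

/-- The ratio ergodic theorem for symmetric sums. -/
theorem ae_tendsto_symmSum_div {T : X ≃ᵐ X} (hc : Conservative T μ)
    (hT : Ergodic T μ) {A : Set X} (hA : MeasurableSet A) (hpos : 0 < μ A) (hfin : μ A < ⊤)
    {f : X → ℝ} (hi : Integrable f μ) :
    ∀ᵐ x ∂μ, Tendsto
      (fun n => symmSum T f n x / symmSum T (A.indicator (fun _ => (1 : ℝ))) n x)
      atTop (𝓝 ((∫ y, f y ∂μ) / μ.real A)) := by
  have he := hi.aestronglyMeasurable.ae_eq_mk
  have := ae_tendsto_symmSum_div_of_measurable hc hT hA hpos hfin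
    hi.aestronglyMeasurable.stronglyMeasurable_mk.measurable (hi.congr he)
  filter_upwards [this, symmSum_ae_eq hT.toMeasurePreserving he] with x h1 h2
  rw [integral_congr_ae he]
  simpa only [h2] using h1

end SymmSum

/-! ### Return sequences and integrals of symmetric sums -/

section ReturnSequence

variable {X : Type*} [MeasurableSpace X] {μ : Measure X}

/-- If `u n` is uniformly bounded and `v n` is asymptotically at least `u n` a.e., then the
integrals of `v n` are asymptotically at least those of `u n`. -/
theorem exists_tendsto_zero_integral_le_add {ν : Measure X} [IsFiniteMeasure ν]
    {u v : ℕ → X → ℝ} {K : ℝ} (hu : ∀ n, Measurable (u n)) (hv : ∀ n, Measurable (v n))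
    (hvi : ∀ n, Integrable (v n) ν) (hu0 : ∀ n, ∀ᵐ x ∂ν, 0 ≤ u n x)
    (huK : ∀ n, ∀ᵐ x ∂ν, u n x ≤ K) (hv0 : ∀ n, ∀ᵐ x ∂ν, 0 ≤ v n x)
    (hlim : ∀ᵐ x ∂ν, Tendsto (fun n => u n x - min (u n x) (v n x)) atTop (𝓝 0)) :
    ∃ e : ℕ → ℝ, Tendsto e atTop (𝓝 0) ∧ ∀ n, ∫ x, u n x ∂ν ≤ ∫ x, v n x ∂ν + e n := by
  have hb : ∀ n, ∀ᵐ x ∂ν, ‖u n x - min (u n x) (v n x)‖ ≤ K := by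
    intro n
    filter_upwards [hu0 n, huK n, hv0 n] with x h1 h2 h3
    rw [Real.norm_eq_abs, abs_of_nonneg (sub_nonneg.2 (min_le_left _ _))]
    linarith [le_min h1 h3]
  have hm : ∀ n, Measurable fun x => u n x - min (u n x) (v n x) :=
    fun n => (hu n).sub ((hu n).min (hv n))
  -- The error is the integral of the positive part of `u n - v n`, which lies between `0` and `K`,
  -- so dominated convergence applies although `v n` has no uniform bound.
  refine ⟨fun n => ∫ x, (u n x - min (u n x) (v n x)) ∂ν, ?_, fun n => ?_⟩
  · have := tendsto_integral_of_dominated_convergence (μ := ν) (fun _ => K)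
      (fun n => (hm n).aestronglyMeasurable) (integrable_const K) hb hlim
    simpa using this
  · have hdi : Integrable (fun x => u n x - min (u n x) (v n x)) ν :=
      Integrable.of_bound (hm n).aestronglyMeasurable K (hb n)
    have hui : Integrable (u n) ν := by
      refine Integrable.of_bound (hu n).aestronglyMeasurable K ?_
      filter_upwards [hu0 n, huK n] with x h1 h2
      rwa [Real.norm_eq_abs, abs_of_nonneg h1]
    rw [← integral_add (hvi n) hdi]
    refine integral_mono hui ((hvi n).add hdi) fun x => ?_
    linarith [min_le_right (u n x) (v n x)]

theorem returnSeq_nonneg (T : X ≃ᵐ X) (A : Set X) (n : ℕ) : 0 ≤ returnSeq μ T A n :=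
  Finset.sum_nonneg fun _ _ => by positivity

theorem returnSeq_mono (T : X ≃ᵐ X) (A : Set X) : Monotone (returnSeq μ T A) :=
  monotone_nat_of_le_succ fun n => by
    rw [returnSeq, returnSeq, Finset.sum_range_succ]
    have : 0 ≤ μ.real (A ∩ (T^[n]) ⁻¹' A) / (μ.real A) ^ 2 := by positivity
    linarith

theorem IsBRESet.measureReal_pos {T : X ≃ᵐ X} {A : Set X} (h : IsBRESet μ T A) :
    0 < μ.real A :=
  ENNReal.toReal_pos h.2.1.ne' h.2.2.1.ne

/-- On a set witnessing bounded rational ergodicity, the one-sided occupation times starting from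
any point of the space are bounded by a multiple of the return sequence. -/
theorem IsBRESet.exists_ae_birkhoffSum_zpow_le {T : X ≃ᵐ X} (hT : MeasurePreserving T μ μ)
    {A : Set X} (h : IsBRESet μ T A) :
    ∃ M : ℝ, 0 < M ∧ ∀ᵐ x ∂μ, ∀ (k : ℤ) (n : ℕ),
      birkhoffSum T (A.indicator (fun _ => (1 : ℝ))) n ((T.toEquiv ^ k : Equiv.Perm X) x)
        ≤ M * returnSeq μ T A n := by
  obtain ⟨hA, hpos, hfin, M, hM⟩ := h
  set p : X → ℝ := A.indicator (fun _ => (1 : ℝ))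
  have hM' : ∀ᵐ x ∂μ, x ∈ A → ∀ n : ℕ, 1 ≤ n → birkhoffSum T p n x ≤ M * returnSeq μ T A n := by
    rw [← ae_restrict_iff' hA]
    exact ae_all_iff.2 fun n => eventually_imp_distrib_left.2 (hM n)
  -- At `n = 1` the sum equals `1` on `A`, while `a_1(A)` is nonnegative.
  have hMpos : 0 < M := by
    have hne : ∃ x ∈ A, birkhoffSum T p 1 x ≤ M * returnSeq μ T A 1 := by
      by_contra! hcon
      have : ∀ᵐ x ∂μ, x ∉ A := by
        filter_upwards [hM'] with x hx hxA
        exact absurd (hx hxA 1 le_rfl) (not_le.2 (hcon x hxA))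
      rw [ae_iff] at this
      simp only [not_not, Set.ofPred_mem_eq] at this
      exact hpos.ne' this
    obtain ⟨x, hxA, hx⟩ := hne
    rw [birkhoffSum_one, show p x = 1 from Set.indicator_of_mem hxA _] at hx
    by_contra hcon
    nlinarith [returnSeq_nonneg (μ := μ) T A 1]
  refine ⟨M, hMpos, ?_⟩
  have hall : ∀ᵐ x ∂μ, ∀ k : ℤ, (T.toEquiv ^ k : Equiv.Perm X) x ∈ A → ∀ n : ℕ, 1 ≤ n →
      birkhoffSum T p n ((T.toEquiv ^ k : Equiv.Perm X) x) ≤ M * returnSeq μ T A n :=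
    ae_all_iff.2 fun k => (measurePreserving_zpow hT k).quasiMeasurePreserving.ae hM'
  filter_upwards [hall] with x hx k n
  induction n generalizing k with
  | zero => simp [returnSeq]
  | succ n ih =>
    -- Outside `A` the first term is zero, so the start moves one step forward with a shorter sum,
    -- until the orbit enters `A`; monotonicity of `a_n(A)` pays for the shortening.
    by_cases hk : (T.toEquiv ^ k : Equiv.Perm X) x ∈ A
    · exact hx k hk (n + 1) (by omega)
    · rw [birkhoffSum_succ', show p ((T.toEquiv ^ k : Equiv.Perm X) x) = 0 from
        Set.indicator_of_notMem hk _, zero_add]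
      have hk1 : T ((T.toEquiv ^ k : Equiv.Perm X) x) = (T.toEquiv ^ (1 + k) : Equiv.Perm X) x := by
        rw [zpow_add, zpow_one]; rfl
      rw [hk1]
      exact (ih (1 + k)).trans
        (mul_le_mul_of_nonneg_left (returnSeq_mono T A n.le_succ) hMpos.le)

/-- The backward orbit segment of `x` is the forward segment started at `T^{-n} x`. This is how a
one-sided hypothesis controls the backward half of a symmetric sum. -/
theorem birkhoffSum_symm_succ (T : X ≃ᵐ X) (f : X → ℝ) (n : ℕ) (x : X) :
    birkhoffSum T.symm f (n + 1) x = birkhoffSum T f (n + 1) (T.symm^[n] x) := by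
  induction n with
  | zero => simp
  | succ n ih =>
    rw [birkhoffSum_succ, ih, Function.iterate_succ_apply',
      birkhoffSum_succ' T f (n + 1) (T.symm _), T.apply_symm_apply]
    ring

theorem IsBRESet.exists_ae_symmSum_le {T : X ≃ᵐ X} (hT : MeasurePreserving T μ μ)
    {A : Set X} (h : IsBRESet μ T A) :
    ∃ M : ℝ, 0 < M ∧ ∀ᵐ x ∂μ, ∀ n : ℕ,
      symmSum T (A.indicator (fun _ => (1 : ℝ))) n x ≤ M * (2 * returnSeq μ T A n) := by
  obtain ⟨M, hM, hb⟩ := h.exists_ae_birkhoffSum_zpow_le hT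
  refine ⟨M, hM, ?_⟩
  filter_upwards [hb] with x hx n
  set p : X → ℝ := A.indicator (fun _ => (1 : ℝ))
  cases n with
  | zero => simp [symmSum, returnSeq]
  | succ n =>
    have h0 : 0 ≤ p x := Set.indicator_nonneg (fun _ _ => zero_le_one) x
    have h1 := hx 0 (n + 1)
    have h2 := hx (-(n : ℤ)) (n + 1)
    rw [zpow_zero, Equiv.Perm.one_apply] at h1
    rw [zpow_neg_natCast_apply, ← birkhoffSum_symm_succ] at h2
    rw [symmSum_eq T p (by omega)]
    linarith

/-- A multiple of `a_n(A)` dominates the symmetric sum of `1_A`, which diverges at almost every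
point; one such point suffices. -/
theorem IsBRESet.tendsto_returnSeq {T : X ≃ᵐ X} (hc : Conservative T μ) (hT : Ergodic T μ)
    {A : Set X} (h : IsBRESet μ T A) : Tendsto (returnSeq μ T A) atTop atTop := by
  obtain ⟨M, hM, hb⟩ := h.exists_ae_symmSum_le hT.toMeasurePreserving
  have hne : NeBot (ae μ) := ae_neBot.2 fun h0 => by simpa [h0] using h.2.1
  obtain ⟨x, hx1, hx2⟩ :=
    (hb.and (ae_tendsto_symmSum_indicator_atTop hc hT h.1 h.2.1)).exists
  have h1 : Tendsto (fun n => (2 * M)⁻¹ * symmSum T (A.indicator (fun _ => (1 : ℝ))) n x)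
      atTop atTop := hx2.const_mul_atTop (by positivity)
  refine tendsto_atTop_mono (fun n => ?_) h1
  rw [inv_mul_le_iff₀ (by positivity)]
  linarith [hx1 n]

theorem setIntegral_indicator_zpow {T : X ≃ᵐ X} (hT : MeasurePreserving T μ μ) {A B : Set X}
    (hB : MeasurableSet B) (k : ℤ) :
    ∫ x in A, B.indicator (fun _ => (1 : ℝ)) ((T.toEquiv ^ k : Equiv.Perm X) x) ∂μ
      = μ.real (A ∩ (T.toEquiv ^ k : Equiv.Perm X) ⁻¹' B) := by
  have hm := (measurePreserving_zpow hT k).measurable hB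
  have := integral_indicator_one (μ := μ.restrict A) hm
  rw [measureReal_restrict_apply hm, Set.inter_comm] at this
  exact this

theorem measureReal_inter_zpow_preimage_comm {T : X ≃ᵐ X} (hT : MeasurePreserving T μ μ)
    {A B : Set X} (hA : MeasurableSet A) (hB : MeasurableSet B) (k : ℤ) :
    μ.real (A ∩ (T.toEquiv ^ (-k) : Equiv.Perm X) ⁻¹' B)
      = μ.real (B ∩ (T.toEquiv ^ k : Equiv.Perm X) ⁻¹' A) := by
  have hm := (measurePreserving_zpow hT (-k)).measurable hB
  rw [measureReal_def, measureReal_def, ← (measurePreserving_zpow hT k).measure_preimage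
    (hA.inter hm).nullMeasurableSet, Set.preimage_inter, ← Set.preimage_comp]
  have : ⇑(T.toEquiv ^ (-k) : Equiv.Perm X) ∘ ⇑(T.toEquiv ^ k : Equiv.Perm X) = id := by
    rw [← Equiv.Perm.coe_mul, ← zpow_add, neg_add_cancel, zpow_zero]; rfl
  rw [this, Set.preimage_id, Set.inter_comm]

theorem integrable_indicator_zpow {T : X ≃ᵐ X} (hT : MeasurePreserving T μ μ) {B : Set X}
    (hB : MeasurableSet B) (hBf : μ B < ⊤) (k : ℤ) :
    Integrable (fun x => B.indicator (fun _ => (1 : ℝ)) ((T.toEquiv ^ k : Equiv.Perm X) x)) μ :=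
  (measurePreserving_zpow hT k).integrable_comp_of_integrable
    ((integrable_indicator_iff hB).2 (integrableOn_const hBf.ne))

theorem setIntegral_symmSum_indicator {T : X ≃ᵐ X} (hT : MeasurePreserving T μ μ) {A B : Set X}
    (hB : MeasurableSet B) (hBf : μ B < ⊤) (n : ℕ) :
    ∫ x in A, symmSum T (B.indicator (fun _ => (1 : ℝ))) n x ∂μ
      = ∑ k ∈ Finset.Ioo (-(n : ℤ)) (n : ℤ),
          μ.real (A ∩ (T.toEquiv ^ k : Equiv.Perm X) ⁻¹' B) := by
  simp only [symmSum]
  rw [integral_finsetSum _ fun k _ => (integrable_indicator_zpow hT hB hBf k).integrableOn]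
  exact Finset.sum_congr rfl fun k _ => setIntegral_indicator_zpow hT hB k

/-- The reflection `k ↦ -k` preserves the range of summation and, by invariance of the measure,
exchanges the roles of `A` and `B`. -/
theorem setIntegral_symmSum_indicator_comm {T : X ≃ᵐ X} (hT : MeasurePreserving T μ μ)
    {A B : Set X} (hA : MeasurableSet A) (hAf : μ A < ⊤) (hB : MeasurableSet B) (hBf : μ B < ⊤)
    (n : ℕ) :
    ∫ x in A, symmSum T (B.indicator (fun _ => (1 : ℝ))) n x ∂μ
      = ∫ x in B, symmSum T (A.indicator (fun _ => (1 : ℝ))) n x ∂μ := by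
  rw [setIntegral_symmSum_indicator hT hB hBf, setIntegral_symmSum_indicator hT hA hAf]
  refine Finset.sum_equiv (Equiv.neg ℤ) (fun k => ?_) fun k _ => ?_
  · simp only [Finset.mem_Ioo, Equiv.neg_apply]; omega
  · rw [Equiv.neg_apply, measureReal_inter_zpow_preimage_comm hT hB hA]

/-- The terms `k` and `-k` have equal measure. The correction `-μ(A)` appears because `2 a_n(A)`
counts `k = 0` twice. -/
theorem setIntegral_symmSum_indicator_self {T : X ≃ᵐ X} (hT : MeasurePreserving T μ μ)
    {A : Set X} (hA : MeasurableSet A) (hpos : 0 < μ.real A) (hAf : μ A < ⊤) {n : ℕ}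
    (hn : 1 ≤ n) :
    ∫ x in A, symmSum T (A.indicator (fun _ => (1 : ℝ))) n x ∂μ
      = μ.real A ^ 2 * (2 * returnSeq μ T A n) - μ.real A := by
  have hcoe : ∀ n : ℕ, (T.toEquiv ^ (n : ℤ) : Equiv.Perm X) ⁻¹' A = T^[n] ⁻¹' A := fun n => by
    ext x; simp only [Set.mem_preimage, zpow_natCast_apply]
  induction n, hn using Nat.le_induction with
  | base =>
    have : Finset.Ioo (-((1 : ℕ) : ℤ)) ((1 : ℕ) : ℤ) = {0} := by decide
    rw [setIntegral_symmSum_indicator hT hA hAf, this]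
    simp [returnSeq]
    field_simp
    ring
  | succ n hn ih =>
    rw [setIntegral_symmSum_indicator hT hA hAf] at ih ⊢
    rw [Ioo_neg_succ_eq_insert hn, Finset.sum_insert, Finset.sum_insert, ih,
      measureReal_inter_zpow_preimage_comm hT hA hA, hcoe, returnSeq, returnSeq,
      Finset.sum_range_succ]
    · field_simp
      ring
    · simp
    · simp only [Finset.mem_insert, Finset.mem_Ioo]; omega

end ReturnSequence

/-! ### Comparison with the return sequence -/

section Comparison

variable {X : Type*} [MeasurableSpace X] {μ : Measure X}

theorem tendsto_sub_min_of_eventually_eq_mul {u v l : ℕ → ℝ} {K : ℝ} (hu0 : ∀ n, 0 ≤ u n)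
    (huK : ∀ n, u n ≤ K) (hv : ∀ᶠ n in atTop, v n = l n * u n) (hl : Tendsto l atTop (𝓝 1)) :
    Tendsto (fun n => u n - min (u n) (v n)) atTop (𝓝 0) := by
  have h1 : Tendsto (fun n => K * |1 - l n|) atTop (𝓝 0) := by
    have := ((tendsto_const_nhds (x := (1 : ℝ))).sub hl).abs.const_mul K
    simpa using this
  refine tendsto_of_tendsto_of_tendsto_of_le_of_le' tendsto_const_nhds h1
    (Eventually.of_forall fun n => sub_nonneg.2 (min_le_left _ _)) ?_
  filter_upwards [hv] with n hn
  have h2 : u n * (1 - l n) ≤ K * |1 - l n| :=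
    (mul_le_mul_of_nonneg_left (le_abs_self _) (hu0 n)).trans
      (mul_le_mul_of_nonneg_right (huK n) (abs_nonneg _))
  have h3 : 0 ≤ K * |1 - l n| := mul_nonneg ((hu0 n).trans (huK n)) (abs_nonneg _)
  rcases min_choice (u n) (v n) with h | h <;> rw [h]
  · linarith
  · rw [hn]; linarith

theorem symmSum_indicator_nonneg (T : X ≃ᵐ X) (A : Set X) (n : ℕ) (x : X) :
    0 ≤ symmSum T (A.indicator (fun _ => (1 : ℝ))) n x :=
  symmSum_nonneg T (fun y => Set.indicator_nonneg (fun _ _ => zero_le_one) y) n x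

theorem symmSum_div_returnSeq_nonneg (T : X ≃ᵐ X) (A B : Set X) (n : ℕ) (x : X) :
    0 ≤ symmSum T (B.indicator (fun _ => (1 : ℝ))) n x / (2 * returnSeq μ T A n) :=
  div_nonneg (symmSum_indicator_nonneg T B n x)
    (mul_nonneg zero_le_two (returnSeq_nonneg T A n))

theorem IsBRESet.exists_ae_symmSum_div_le {T : X ≃ᵐ X} (hT : MeasurePreserving T μ μ)
    {A : Set X} (h : IsBRESet μ T A) :
    ∃ M : ℝ, 0 < M ∧ ∀ᵐ x ∂μ, ∀ n : ℕ,
      symmSum T (A.indicator (fun _ => (1 : ℝ))) n x / (2 * returnSeq μ T A n) ≤ M := by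
  obtain ⟨M, hM, hb⟩ := h.exists_ae_symmSum_le hT
  refine ⟨M, hM, ?_⟩
  filter_upwards [hb] with x hx n
  exact div_le_of_le_mul₀ (mul_nonneg zero_le_two (returnSeq_nonneg T A n)) hM.le (hx n)

theorem IsBRESet.tendsto_two_mul_returnSeq {T : X ≃ᵐ X} (hc : Conservative T μ)
    (hT : Ergodic T μ) {A : Set X} (h : IsBRESet μ T A) :
    Tendsto (fun n => 2 * returnSeq μ T A n) atTop atTop :=
  (h.tendsto_returnSeq hc hT).const_mul_atTop two_pos

theorem measurable_symmSum_indicator_div {T : X ≃ᵐ X} (hT : MeasurePreserving T μ μ)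
    {B : Set X} (hB : MeasurableSet B) (a : ℕ → ℝ) (n : ℕ) :
    Measurable fun x => symmSum T (B.indicator (fun _ => (1 : ℝ))) n x / a n :=
  (measurable_symmSum hT (measurable_const.indicator hB) n).div_const _

theorem integrable_symmSum_indicator_div {T : X ≃ᵐ X} (hT : MeasurePreserving T μ μ)
    {B : Set X} (hB : MeasurableSet B) (hBf : μ B < ⊤) (a : ℕ → ℝ) (n : ℕ) :
    Integrable (fun x => symmSum T (B.indicator (fun _ => (1 : ℝ))) n x / a n) μ :=
  (integrable_symmSum hT ((integrable_indicator_iff hB).2 (integrableOn_const hBf.ne))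
    n).div_const _

/-- The averages over `A` of the normalized symmetric sums of `1_A` converge. -/
theorem IsBRESet.tendsto_setIntegral_symmSum_div {T : X ≃ᵐ X} (hc : Conservative T μ)
    (hT : Ergodic T μ) {A : Set X} (h : IsBRESet μ T A) :
    Tendsto (fun n => ∫ x in A,
      symmSum T (A.indicator (fun _ => (1 : ℝ))) n x / (2 * returnSeq μ T A n) ∂μ)
      atTop (𝓝 (μ.real A ^ 2)) := by
  have ha := h.tendsto_two_mul_returnSeq hc hT
  have h1 : Tendsto (fun n => μ.real A ^ 2 - μ.real A / (2 * returnSeq μ T A n)) atTop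
      (𝓝 (μ.real A ^ 2)) := by
    simpa using (tendsto_const_nhds (x := μ.real A ^ 2)).sub (ha.const_div_atTop (μ.real A))
  refine h1.congr' ?_
  filter_upwards [ha.eventually_gt_atTop 0, eventually_ge_atTop 1] with n hn hn1
  rw [integral_div, setIntegral_symmSum_indicator_self hT.toMeasurePreserving h.1
    h.measureReal_pos h.2.2.1 hn1, sub_div, mul_div_cancel_right₀ _ hn.ne']

/-- A numerical sequence that is a.e. eventually below the normalized symmetric sums of `1_A` has
upper limit at most the measure of `A`. -/
theorem IsBRESet.eventually_le_of_ae_eventually_le {T : X ≃ᵐ X} (hc : Conservative T μ)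
    (hT : Ergodic T μ) {A : Set X} (h : IsBRESet μ T A) {r : ℕ → ℝ}
    (hr : ∀ᵐ x ∂μ, ∀ᶠ n in atTop,
      r n ≤ symmSum T (A.indicator (fun _ => (1 : ℝ))) n x / (2 * returnSeq μ T A n))
    {y : ℝ} (hy : μ.real A < y) : ∀ᶠ n in atTop, r n ≤ y := by
  have hα := h.measureReal_pos
  have : IsFiniteMeasure (μ.restrict A) := ⟨by simpa using h.2.2.1⟩
  obtain ⟨e, he, hle⟩ := exists_tendsto_zero_integral_le_add (ν := μ.restrict A)
    -- Truncation to `[0, y]` supplies the bounds needed and loses nothing: a truncated value below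
    -- `y` still forces `r n < y`.
    (u := fun n _ => max 0 (min (r n) y))
    (v := fun n x => symmSum T (A.indicator (fun _ => (1 : ℝ))) n x / (2 * returnSeq μ T A n))
    (K := y) (fun n => measurable_const)
    (fun n => measurable_symmSum_indicator_div hT.toMeasurePreserving h.1
      (fun n => 2 * returnSeq μ T A n) n)
    (fun n =>
      (integrable_symmSum_indicator_div hT.toMeasurePreserving h.1 h.2.2.1
        (fun n => 2 * returnSeq μ T A n) n).integrableOn)
    (fun n => ae_of_all _ fun x => le_max_left _ _)
    (fun n => ae_of_all _ fun x => max_le (hα.trans hy).le (min_le_right _ _))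
    (fun n => ae_of_all _ fun x => symmSum_div_returnSeq_nonneg T A A n x) (by
      filter_upwards [ae_restrict_of_ae hr] with x hx
      refine tendsto_const_nhds.congr' ?_
      filter_upwards [hx] with n hn
      rw [min_eq_left (a := max 0 (min (r n) y)), sub_self]
      exact max_le (symmSum_div_returnSeq_nonneg T A A n x) ((min_le_left _ _).trans hn))
  have hlim := (h.tendsto_setIntegral_symmSum_div hc hT).add he
  rw [add_zero] at hlim
  have hlt : μ.real A ^ 2 < μ.real A * y := by nlinarith
  filter_upwards [hlim.eventually (gt_mem_nhds hlt)] with n hn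
  have h1 := (hle n).trans_lt hn
  rw [integral_const, measureReal_restrict_apply_univ, smul_eq_mul] at h1
  have h2 := lt_of_mul_lt_mul_left h1 hα.le
  have h3 := (max_lt_iff.1 h2).2
  exact ((min_lt_iff.1 h3).resolve_right (lt_irrefl _)).le

/-- A numerical sequence that is a.e. eventually above the normalized symmetric sums of `1_A` has
lower limit at least the measure of `A`. -/
theorem IsBRESet.eventually_ge_of_ae_eventually_ge {T : X ≃ᵐ X} (hc : Conservative T μ)
    (hT : Ergodic T μ) {A : Set X} (h : IsBRESet μ T A) {r : ℕ → ℝ}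
    (hr : ∀ᵐ x ∂μ, ∀ᶠ n in atTop,
      symmSum T (A.indicator (fun _ => (1 : ℝ))) n x / (2 * returnSeq μ T A n) ≤ r n)
    {y : ℝ} (hy : y < μ.real A) : ∀ᶠ n in atTop, y ≤ r n := by
  have hα := h.measureReal_pos
  have : IsFiniteMeasure (μ.restrict A) := ⟨by simpa using h.2.2.1⟩
  obtain ⟨M, hM, hb⟩ := h.exists_ae_symmSum_div_le hT.toMeasurePreserving
  obtain ⟨e, he, hle⟩ := exists_tendsto_zero_integral_le_add (ν := μ.restrict A)
    (u := fun n x => symmSum T (A.indicator (fun _ => (1 : ℝ))) n x / (2 * returnSeq μ T A n))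
    (v := fun n _ => max 0 (r n))
    (K := M) (fun n => measurable_symmSum_indicator_div hT.toMeasurePreserving h.1
      (fun n => 2 * returnSeq μ T A n) n)
    (fun n => measurable_const) (fun n => integrable_const _)
    (fun n => ae_of_all _ fun x => symmSum_div_returnSeq_nonneg T A A n x)
    (fun n => ae_restrict_of_ae (hb.mono fun x hx => hx n))
    (fun n => ae_of_all _ fun x => le_max_left _ _) (by
      filter_upwards [ae_restrict_of_ae hr] with x hx
      refine tendsto_const_nhds.congr' ?_
      filter_upwards [hx] with n hn
      rw [min_eq_left (le_max_of_le_right hn), sub_self])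
  have hlim := (h.tendsto_setIntegral_symmSum_div hc hT).sub he
  rw [sub_zero] at hlim
  have hlt : μ.real A * max 0 y < μ.real A ^ 2 := by nlinarith [max_lt hα hy]
  filter_upwards [hlim.eventually (lt_mem_nhds hlt)] with n hn
  have h1 := hle n
  rw [integral_const, measureReal_restrict_apply_univ, smul_eq_mul] at h1
  have h2 := lt_of_mul_lt_mul_left (hn.trans_le (sub_le_iff_le_add.2 h1)) hα.le
  rcases lt_max_iff.1 h2 with h3 | h3
  · exact absurd h3 (not_lt.2 (le_max_left _ _))
  · exact (le_max_right _ _).trans h3.le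

/-- The ratio theorem, integrated over `A`, compares `∫_A s` with `∫_A t`, where `s`, `t` are the
sums of `1_A`, `1_B`. The latter equals `∫_B s` by symmetry, and the ratio theorem over `B` compares
that with `∫_B t`. Only `s` has to be bounded after normalization, so `B` may be any set of finite
positive measure. -/
theorem IsBRESet.exists_tendsto_zero_one_sub_le {T : X ≃ᵐ X} (hc : Conservative T μ)
    (hT : Ergodic T μ) {A B : Set X} (h : IsBRESet μ T A) (hB : MeasurableSet B)
    (hBp : 0 < μ B) (hBf : μ B < ⊤) :
    ∃ δ : ℕ → ℝ, Tendsto δ atTop (𝓝 0) ∧ ∀ᶠ n in atTop,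
      1 - δ n ≤ (2 * returnSeq μ T B n) / (2 * returnSeq μ T A n) := by
  have hα := h.measureReal_pos
  have hβ : 0 < μ.real B := ENNReal.toReal_pos hBp.ne' hBf.ne
  have hmp := hT.toMeasurePreserving
  set α := μ.real A
  set β := μ.real B
  have : IsFiniteMeasure (μ.restrict A) := ⟨by simpa using h.2.2.1⟩
  have : IsFiniteMeasure (μ.restrict B) := ⟨by simpa using hBf⟩
  have ha := h.tendsto_two_mul_returnSeq hc hT
  obtain ⟨M, hM, hb⟩ := h.exists_ae_symmSum_div_le hmp
  set s : ℕ → X → ℝ := symmSum T (A.indicator (fun _ => (1 : ℝ)))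
  set t : ℕ → X → ℝ := symmSum T (B.indicator (fun _ => (1 : ℝ)))
  set a : ℕ → ℝ := fun n => 2 * returnSeq μ T A n
  have hratio : ∀ᵐ x ∂μ, Tendsto (fun n => t n x / s n x * (α / β)) atTop (𝓝 1) := by
    have := ae_tendsto_symmSum_div hc hT h.1 h.2.1 h.2.2.1
      ((integrable_indicator_iff hB).2 (integrableOn_const (C := (1 : ℝ)) hBf.ne))
    filter_upwards [this] with x hx
    have h1 := hx.mul_const (α / β)
    rwa [integral_indicator_const _ hB, smul_eq_mul, mul_one, div_mul_div_cancel₀ hα.ne',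
      div_self hβ.ne'] at h1
  have hpos := ae_tendsto_symmSum_indicator_atTop hc hT h.1 h.2.1
  have hsa0 : ∀ n x, 0 ≤ s n x / a n := symmSum_div_returnSeq_nonneg T A A
  have hta0 : ∀ n x, 0 ≤ t n x / a n := symmSum_div_returnSeq_nonneg T A B
  have hsm := measurable_symmSum_indicator_div hmp h.1 a
  have htm := measurable_symmSum_indicator_div hmp hB a
  have hti := integrable_symmSum_indicator_div hmp hB hBf a
  obtain ⟨e₁, he₁, hle₁⟩ := exists_tendsto_zero_integral_le_add (ν := μ.restrict A)
    (u := fun n x => β / α * (s n x / a n)) (v := fun n x => t n x / a n) (K := β / α * M)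
    (fun n => (hsm n).const_mul _) htm (fun n => (hti n).integrableOn)
    (fun n => ae_of_all _ fun x => mul_nonneg (by positivity) (hsa0 n x))
    (fun n => ae_restrict_of_ae (hb.mono fun x hx =>
      mul_le_mul_of_nonneg_left (hx n) (by positivity)))
    (fun n => ae_of_all _ (hta0 n)) (by
      refine ae_restrict_of_ae ?_
      filter_upwards [hratio, hpos, hb] with x h1 h2 h3
      refine tendsto_sub_min_of_eventually_eq_mul (K := β / α * M)
        (fun n => mul_nonneg (by positivity) (hsa0 n x))
        (fun n => mul_le_mul_of_nonneg_left (h3 n) (by positivity)) ?_ h1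
      filter_upwards [h2.eventually_gt_atTop 0] with n hn
      have : s n x ≠ 0 := hn.ne'
      field_simp)
  obtain ⟨e₂, he₂, hle₂⟩ := exists_tendsto_zero_integral_le_add (ν := μ.restrict B)
    (u := fun n x => s n x / a n) (v := fun n x => α / β * (t n x / a n)) (K := M)
    hsm (fun n => (htm n).const_mul _) (fun n => ((hti n).const_mul _).integrableOn)
    (fun n => ae_of_all _ (hsa0 n))
    (fun n => ae_restrict_of_ae (hb.mono fun x hx => hx n))
    (fun n => ae_of_all _ fun x => mul_nonneg (by positivity) (hta0 n x)) (by
      refine ae_restrict_of_ae ?_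
      filter_upwards [hratio, hpos, hb] with x h1 h2 h3
      refine tendsto_sub_min_of_eventually_eq_mul (K := M) (fun n => hsa0 n x) h3 ?_ h1
      filter_upwards [h2.eventually_gt_atTop 0] with n hn
      have : s n x ≠ 0 := hn.ne'
      field_simp)
  -- The chain of comparisons gives `α β - β / a n ≤ α β (2 a_n(B) / a n) - α / a n + e₁ n + e₂ n`;
  -- the term `-α / a n` is dropped and the rest divided by `α β`.
  refine ⟨fun n => (β / a n + e₁ n + e₂ n) / (α * β), ?_, ?_⟩
  · have := (((ha.const_div_atTop β).add he₁).add he₂).div_const (α * β)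
    simpa using this
  · filter_upwards [ha.eventually_gt_atTop 0, eventually_ge_atTop 1] with n hn hn1
    have han : 0 < a n := hn
    have h1 := hle₁ n
    have h2 := hle₂ n
    rw [integral_const_mul, integral_div, integral_div,
      setIntegral_symmSum_indicator_self hmp h.1 hα h.2.2.1 hn1,
      setIntegral_symmSum_indicator_comm hmp h.1 h.2.2.1 hB hBf n] at h1
    rw [integral_const_mul, integral_div, integral_div,
      setIntegral_symmSum_indicator_self hmp hB hβ hBf hn1] at h2
    have h3 := h1.trans (add_le_add_left h2 _)
    change β / α * ((α ^ 2 * a n - α) / a n) ≤ _ at h3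
    change _ ≤ (2 * returnSeq μ T B n) / a n
    have h4 : β / α * ((α ^ 2 * a n - α) / a n) = α * β - β / a n := by field_simp
    have h5 : α / β * ((β ^ 2 * (2 * returnSeq μ T B n) - β) / a n)
        = α * β * (2 * returnSeq μ T B n / a n) - α / a n := by field_simp
    have h6 : 0 ≤ α / a n := by positivity
    rw [h4] at h3
    change _ ≤ α / β * ((β ^ 2 * (2 * returnSeq μ T B n) - β) / a n) + _ + _ at h3
    rw [h5] at h3
    rw [sub_le_iff_le_add, ← sub_le_iff_le_add', le_div_iff₀ (by positivity)]
    nlinarith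

/-- All return sequences of sets witnessing bounded rational ergodicity are asymptotic. -/
theorem IsBRESet.tendsto_returnSeq_div {T : X ≃ᵐ X} (hc : Conservative T μ)
    (hT : Ergodic T μ) {A B : Set X} (hA : IsBRESet μ T A) (hB : IsBRESet μ T B) :
    Tendsto (fun n => (2 * returnSeq μ T B n) / (2 * returnSeq μ T A n)) atTop (𝓝 1) := by
  obtain ⟨δ, hδ, h1⟩ := hA.exists_tendsto_zero_one_sub_le hc hT hB.1 hB.2.1 hB.2.2.1
  obtain ⟨δ', hδ', h2⟩ := hB.exists_tendsto_zero_one_sub_le hc hT hA.1 hA.2.1 hA.2.2.1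
  have l1 : Tendsto (fun n => 1 - δ n) atTop (𝓝 1) := by
    simpa using (tendsto_const_nhds (x := (1 : ℝ))).sub hδ
  have l2 : Tendsto (fun n => 1 - δ' n) atTop (𝓝 1) := by
    simpa using (tendsto_const_nhds (x := (1 : ℝ))).sub hδ'
  have l3 : Tendsto (fun n => (1 - δ' n)⁻¹) atTop (𝓝 1) := by
    simpa using l2.inv₀ one_ne_zero
  -- The lower bound with `A` and `B` exchanged becomes an upper bound on inverting the ratio.
  refine tendsto_of_tendsto_of_tendsto_of_le_of_le' l1 l3 h1 ?_
  filter_upwards [h2, l2.eventually (lt_mem_nhds one_pos)] with n hn hn'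
  rw [← inv_div]
  exact inv_anti₀ hn' hn

end Comparison

/-! ### Almost everywhere constant rates and their bounds -/

section Rates

theorem liminf_coe_mul_of_tendsto {l y : ℕ → ℝ} {L : ℝ} (hL : 0 < L)
    (hl : Tendsto l atTop (𝓝 L)) (hy : ∀ᶠ n in atTop, 0 ≤ y n) :
    liminf (fun n => ((l n * y n : ℝ) : EReal)) atTop
      = (L : EReal) * liminf (fun n => (y n : EReal)) atTop := by
  have hl' : Tendsto (fun n => (l n : EReal)) atTop (𝓝 (L : EReal)) := EReal.tendsto_coe.2 hl
  have hl0 : 0 ≤ᶠ[atTop] fun n => (l n : EReal) :=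
    (hl.eventually (lt_mem_nhds hL)).mono fun n hn => EReal.coe_nonneg.2 hn.le
  have hy0 : 0 ≤ᶠ[atTop] fun n => (y n : EReal) := hy.mono fun n hn => EReal.coe_nonneg.2 hn
  have hmul : (fun n => ((l n * y n : ℝ) : EReal))
      = (fun n => (l n : EReal)) * fun n => (y n : EReal) := by
    ext n; simp
  rw [hmul]
  refine le_antisymm ?_ ?_
  · refine (EReal.liminf_mul_le hl0 hy0 (Or.inl ?_) (Or.inl ?_)).trans_eq (by rw [hl'.limsup_eq])
    · rw [hl'.limsup_eq]; exact_mod_cast hL.ne'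
    · rw [hl'.limsup_eq]; exact EReal.coe_ne_top _
  · exact (by rw [hl'.liminf_eq] : _ = _).trans_le (EReal.le_liminf_mul hl0 hy0)

theorem limsup_coe_mul_of_tendsto {l y : ℕ → ℝ} {L : ℝ} (hL : 0 < L)
    (hl : Tendsto l atTop (𝓝 L)) (hy : ∀ᶠ n in atTop, 0 ≤ y n) :
    limsup (fun n => ((l n * y n : ℝ) : EReal)) atTop
      = (L : EReal) * limsup (fun n => (y n : EReal)) atTop := by
  have hl' : Tendsto (fun n => (l n : EReal)) atTop (𝓝 (L : EReal)) := EReal.tendsto_coe.2 hl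
  have hl0 : 0 ≤ᶠ[atTop] fun n => (l n : EReal) :=
    (hl.eventually (lt_mem_nhds hL)).mono fun n hn => EReal.coe_nonneg.2 hn.le
  have hy0 : 0 ≤ᶠ[atTop] fun n => (y n : EReal) := hy.mono fun n hn => EReal.coe_nonneg.2 hn
  have hmul : (fun n => ((l n * y n : ℝ) : EReal))
      = (fun n => (l n : EReal)) * fun n => (y n : EReal) := by
    ext n; simp
  refine le_antisymm ?_ ?_
  · rw [hmul]
    refine (EReal.limsup_mul_le hl0.frequently hy0 (Or.inl ?_) (Or.inl ?_)).trans_eq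
      (by rw [hl'.limsup_eq])
    · rw [hl'.limsup_eq]; exact_mod_cast hL.ne'
    · rw [hl'.limsup_eq]; exact EReal.coe_ne_top _
  · rw [hmul, mul_comm, mul_comm (fun n => (l n : EReal))]
    exact (by rw [hl'.liminf_eq] : _ = _).trans_le (EReal.le_limsup_mul hy0.frequently hl0)

variable {X : Type*} [MeasurableSpace X] {μ : Measure X}

/-- Serves both for replacing `f` by an indicator at one point and for moving from `x` to `T x`. A
positive finite `L` rules out the products `0 * ⊤` in `EReal`. -/
theorem rates_eq_mul_of_tendsto {T : X ≃ᵐ X} {a b l : ℕ → ℝ} {f g : X → ℝ} {x y : X} {L : ℝ}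
    (hL : 0 < L) (hl : Tendsto l atTop (𝓝 L)) (hb : ∀ᶠ n in atTop, 0 ≤ symmSum T g n y / b n)
    (h : ∀ᶠ n in atTop, symmSum T f n x / a n = l n * (symmSum T g n y / b n)) :
    lowerRate T a f x = (L : EReal) * lowerRate T b g y ∧
      upperRate T a f x = (L : EReal) * upperRate T b g y := by
  have h' : ∀ᶠ n in atTop, ((symmSum T f n x / a n : ℝ) : EReal)
      = ((l n * (symmSum T g n y / b n) : ℝ) : EReal) := h.mono fun n hn => by rw [hn]
  constructor
  · rw [lowerRate, liminf_congr h', liminf_coe_mul_of_tendsto hL hl hb, lowerRate]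
  · rw [upperRate, limsup_congr h', limsup_coe_mul_of_tendsto hL hl hb, upperRate]

/-- The rates of an integrable function are proportional to those of an indicator. -/
theorem ae_rates_eq_mul {T : X ≃ᵐ X} (hc : Conservative T μ)
    (hT : Ergodic T μ) {A : Set X} (hA : MeasurableSet A) (hpos : 0 < μ A) (hfin : μ A < ⊤)
    {f : X → ℝ} (hi : Integrable f μ) (hf : 0 < ∫ y, f y ∂μ) :
    ∀ᵐ x ∂μ, ∀ a b : ℕ → ℝ, Tendsto b atTop atTop → Tendsto (fun n => b n / a n) atTop (𝓝 1) →
      lowerRate T a f x = (((∫ y, f y ∂μ) / μ.real A : ℝ) : EReal) *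
        lowerRate T b (A.indicator (fun _ => (1 : ℝ))) x ∧
      upperRate T a f x = (((∫ y, f y ∂μ) / μ.real A : ℝ) : EReal) *
        upperRate T b (A.indicator (fun _ => (1 : ℝ))) x := by
  have hα : 0 < μ.real A := ENNReal.toReal_pos hpos.ne' hfin.ne
  filter_upwards [ae_tendsto_symmSum_div hc hT hA hpos hfin hi,
    ae_tendsto_symmSum_indicator_atTop hc hT hA hpos] with x h1 h2 a b hb hab
  have h3 := h1.mul hab
  rw [mul_one] at h3
  refine rates_eq_mul_of_tendsto (div_pos hf hα) h3 ?_ ?_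
  · filter_upwards [hb.eventually_gt_atTop 0] with n hn
    exact div_nonneg (symmSum_indicator_nonneg T A n x) hn.le
  · filter_upwards [hb.eventually_gt_atTop 0, h2.eventually_gt_atTop 0] with n hn hn'
    have h4 := hn.ne'
    have h5 := hn'.ne'
    field_simp

/-- Covers `∫ f = 0`, where the proportionality factor to the indicator would vanish. -/
theorem ae_rates_eq_zero {T : X ≃ᵐ X} (hT : MeasurePreserving T μ μ) {f : X → ℝ}
    (hf : f =ᵐ[μ] 0) : ∀ᵐ x ∂μ, ∀ a : ℕ → ℝ, lowerRate T a f x = 0 ∧ upperRate T a f x = 0 := by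
  filter_upwards [symmSum_ae_eq hT hf] with x hx a
  have h0 : ∀ n, symmSum T f n x = 0 := fun n => by rw [hx]; simp [symmSum]
  simp [lowerRate, upperRate, h0]

/-- By ergodicity, the rates of an indicator are almost everywhere constant. -/
theorem exists_ae_rates_indicator_eq {T : X ≃ᵐ X} (hc : Conservative T μ)
    (hT : Ergodic T μ) {A : Set X} (hA : MeasurableSet A) (hpos : 0 < μ A)
    {a : ℕ → ℝ} (ha : Tendsto a atTop atTop) :
    ∃ c C : EReal, ∀ᵐ x ∂μ, lowerRate T a (A.indicator (fun _ => (1 : ℝ))) x = c ∧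
      upperRate T a (A.indicator (fun _ => (1 : ℝ))) x = C := by
  set p : X → ℝ := A.indicator (fun _ => (1 : ℝ))
  have hm : ∀ n, Measurable fun x => ((symmSum T p n x / a n : ℝ) : EReal) := fun n =>
    (measurable_symmSum_indicator_div hT.toMeasurePreserving hA a n).coe_real_ereal
  have hinv : ∀ᵐ x ∂μ, lowerRate T a p (T x) = lowerRate T a p x ∧
      upperRate T a p (T x) = upperRate T a p x := by
    filter_upwards [ae_tendsto_symmSum_indicator_atTop hc hT hA hpos] with x hx
    -- The two sums differ by at most `3` and the denominator diverges.
    have h1 : Tendsto (fun n => symmSum T p n (T x) / symmSum T p n x) atTop (𝓝 1) := by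
      rw [tendsto_iff_norm_sub_tendsto_zero]
      refine squeeze_zero' (Eventually.of_forall fun n => norm_nonneg _) ?_
        (hx.const_div_atTop 3)
      filter_upwards [hx.eventually_gt_atTop 0] with n hn
      have h2 := abs_symmSum_indicator_apply_sub_le T A n x
      rw [div_sub_one hn.ne', Real.norm_eq_abs, abs_div, abs_of_pos hn]
      gcongr
    have h3 := rates_eq_mul_of_tendsto (T := T) (a := a) (b := a) (f := p) (g := p) (x := T x)
      (y := x) one_pos h1 (by
        filter_upwards [ha.eventually_gt_atTop 0] with n hn
        exact div_nonneg (symmSum_indicator_nonneg T A n x) hn.le) (by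
        filter_upwards [hx.eventually_gt_atTop 0] with n hn
        have : symmSum T p n x ≠ 0 := hn.ne'
        field_simp)
    simpa using h3
  obtain ⟨c, hcc⟩ := hT.ae_eq_const_of_ae_eq_comp₀ (g := lowerRate T a p)
    (Measurable.liminf hm).nullMeasurable (hinv.mono fun x hx => hx.1)
  obtain ⟨C, hCC⟩ := hT.ae_eq_const_of_ae_eq_comp₀ (g := upperRate T a p)
    (Measurable.limsup hm).nullMeasurable (hinv.mono fun x hx => hx.2)
  exact ⟨c, C, hcc.and hCC⟩

theorem IsBRESet.exists_real_ae_rates_eq {T : X ≃ᵐ X} (hc : Conservative T μ)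
    (hT : Ergodic T μ) {A : Set X} (h : IsBRESet μ T A) :
    ∃ b B : ℝ, 0 ≤ b ∧ b ≤ μ.real A ∧ μ.real A ≤ B ∧ ∀ᵐ x ∂μ,
      lowerRate T (fun n => 2 * returnSeq μ T A n) (A.indicator (fun _ => (1 : ℝ))) x = b ∧
      upperRate T (fun n => 2 * returnSeq μ T A n) (A.indicator (fun _ => (1 : ℝ))) x = B := by
  obtain ⟨c, C, hcC⟩ := exists_ae_rates_indicator_eq hc hT h.1 h.2.1
    (h.tendsto_two_mul_returnSeq hc hT)
  obtain ⟨M, hM, hb⟩ := h.exists_ae_symmSum_div_le hT.toMeasurePreserving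
  have hne : NeBot (ae μ) := ae_neBot.2 fun h0 => by simpa [h0] using h.2.1
  obtain ⟨x, ⟨hx1, hx2⟩, hx3⟩ := (hcC.and hb).exists
  have hc0 : 0 ≤ c := by
    rw [← hx1]
    exact le_liminf_of_le (by isBoundedDefault) (Eventually.of_forall fun n =>
      EReal.coe_nonneg.2 (symmSum_div_returnSeq_nonneg T A A n x))
  have hCM : C ≤ (M : EReal) := by
    rw [← hx2]
    exact limsup_le_of_le (by isBoundedDefault) (Eventually.of_forall fun n =>
      EReal.coe_le_coe_iff.2 (hx3 n))
  have hcleC : c ≤ C := by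
    rw [← hx1, ← hx2]
    exact liminf_le_limsup
  lift c to ℝ using ⟨((hcleC.trans hCM).trans_lt (EReal.coe_lt_top M)).ne,
    (EReal.bot_lt_zero.trans_le hc0).ne'⟩
  lift C to ℝ using ⟨(hCM.trans_lt (EReal.coe_lt_top M)).ne,
    (EReal.bot_lt_zero.trans_le (hc0.trans hcleC)).ne'⟩
  refine ⟨c, C, EReal.coe_nonneg.1 hc0, ?_, ?_, hcC⟩
  -- If `μ(A) < z < y < b`, the constant sequence `y` is a.e. eventually below the normalized sums,
  -- so the average bound gives `y ≤ z`. The upper constant is treated in the same way.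
  · by_contra! hlt
    obtain ⟨y, hy1, hy2⟩ := exists_between hlt
    obtain ⟨z, hz1, hz2⟩ := exists_between hy1
    have := h.eventually_le_of_ae_eventually_le hc hT (r := fun _ => y) (by
      filter_upwards [hcC] with x hx
      have h1 : (y : EReal) < lowerRate T (fun n => 2 * returnSeq μ T A n)
          (A.indicator (fun _ => (1 : ℝ))) x := by rw [hx.1]; exact_mod_cast hy2
      exact (eventually_lt_of_lt_liminf h1).mono fun n hn => (EReal.coe_lt_coe_iff.1 hn).le) hz1
    obtain ⟨n, hn⟩ := this.exists
    linarith
  · by_contra! hlt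
    obtain ⟨y, hy1, hy2⟩ := exists_between hlt
    obtain ⟨z, hz1, hz2⟩ := exists_between hy2
    have := h.eventually_ge_of_ae_eventually_ge hc hT (r := fun _ => y) (by
      filter_upwards [hcC] with x hx
      have h1 : upperRate T (fun n => 2 * returnSeq μ T A n)
          (A.indicator (fun _ => (1 : ℝ))) x < (y : EReal) := by rw [hx.2]; exact_mod_cast hy1
      exact (eventually_lt_of_limsup_lt h1).mono fun n hn => (EReal.coe_lt_coe_iff.1 hn).le) hz2
    obtain ⟨n, hn⟩ := this.exists
    linarith

theorem IsBRESet.isLowerBeta_and_isUpperBeta {T : X ≃ᵐ X} (hc : Conservative T μ)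
    (hT : Ergodic T μ) {A : Set X} (h : IsBRESet μ T A) {b B : ℝ}
    (hbB : ∀ᵐ x ∂μ,
      lowerRate T (fun n => 2 * returnSeq μ T A n) (A.indicator (fun _ => (1 : ℝ))) x = b ∧
      upperRate T (fun n => 2 * returnSeq μ T A n) (A.indicator (fun _ => (1 : ℝ))) x = B) :
    IsLowerBeta μ T (b / μ.real A) ∧ IsUpperBeta μ T (B / μ.real A) := by
  have key : ∀ A' : Set X, IsBRESet μ T A' → ∀ f : X → ℝ, Integrable f μ → 0 ≤ᵐ[μ] f →
      ∀ᵐ x ∂μ, lowerRate T (fun n => 2 * returnSeq μ T A' n) f x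
          = ((b / μ.real A * ∫ y, f y ∂μ : ℝ) : EReal) ∧
        upperRate T (fun n => 2 * returnSeq μ T A' n) f x
          = ((B / μ.real A * ∫ y, f y ∂μ : ℝ) : EReal) := by
    intro A' hA' f hi hf
    rcases (integral_nonneg_of_ae hf).eq_or_lt' with h0 | h0
    · filter_upwards [ae_rates_eq_zero hT.toMeasurePreserving
        ((integral_eq_zero_iff_of_nonneg_ae hf hi).1 h0)] with x hx
      rw [h0, (hx _).1, (hx _).2]
      simp
    · filter_upwards [ae_rates_eq_mul hc hT h.1 h.2.1 h.2.2.1 hi h0, hbB] with x hx hx'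
      obtain ⟨h1, h2⟩ := hx (fun n => 2 * returnSeq μ T A' n) (fun n => 2 * returnSeq μ T A n)
        (h.tendsto_two_mul_returnSeq hc hT) (hA'.tendsto_returnSeq_div hc hT h)
      rw [h1, h2, hx'.1, hx'.2, ← EReal.coe_mul, ← EReal.coe_mul]
      constructor <;> congr 1 <;> ring
  exact ⟨fun A' hA' f hi hf => (key A' hA' f hi hf).mono fun x hx => hx.1,
    fun A' hA' f hi hf => (key A' hA' f hi hf).mono fun x hx => hx.2⟩

theorem IsBRESet.isLowerBeta_unique {T : X ≃ᵐ X} {A : Set X} (h : IsBRESet μ T A) {β β' : ℝ}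
    (hβ : IsLowerBeta μ T β) (hβ' : IsLowerBeta μ T β') : β = β' := by
  have hne : NeBot (ae μ) := ae_neBot.2 fun h0 => by simpa [h0] using h.2.1
  have hi : Integrable (A.indicator (fun _ => (1 : ℝ))) μ :=
    (integrable_indicator_iff h.1).2 (integrableOn_const h.2.2.1.ne)
  have h0 : 0 ≤ᵐ[μ] A.indicator (fun _ => (1 : ℝ)) :=
    ae_of_all _ fun y => Set.indicator_nonneg (fun _ _ => zero_le_one) y
  obtain ⟨x, h1, h2⟩ := ((hβ A h _ hi h0).and (hβ' A h _ hi h0)).exists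
  rw [h1, EReal.coe_eq_coe_iff, integral_indicator_const _ h.1, smul_eq_mul, mul_one] at h2
  exact mul_right_cancel₀ h.measureReal_pos.ne' h2

theorem IsBRESet.isUpperBeta_unique {T : X ≃ᵐ X} {A : Set X} (h : IsBRESet μ T A) {β β' : ℝ}
    (hβ : IsUpperBeta μ T β) (hβ' : IsUpperBeta μ T β') : β = β' := by
  have hne : NeBot (ae μ) := ae_neBot.2 fun h0 => by simpa [h0] using h.2.1
  have hi : Integrable (A.indicator (fun _ => (1 : ℝ))) μ :=
    (integrable_indicator_iff h.1).2 (integrableOn_const h.2.2.1.ne)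
  have h0 : 0 ≤ᵐ[μ] A.indicator (fun _ => (1 : ℝ)) :=
    ae_of_all _ fun y => Set.indicator_nonneg (fun _ _ => zero_le_one) y
  obtain ⟨x, h1, h2⟩ := ((hβ A h _ hi h0).and (hβ' A h _ hi h0)).exists
  rw [h1, EReal.coe_eq_coe_iff, integral_indicator_const _ h.1, smul_eq_mul, mul_one] at h2
  exact mul_right_cancel₀ h.measureReal_pos.ne' h2

/-- If the rates along `a` are positive and finite, they constrain those along the return sequence,
and `a` is comparable to the return sequence. -/
theorem IsBRESet.rates_le_and_isTheta {T : X ≃ᵐ X} (hc : Conservative T μ)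
    (hT : Ergodic T μ) {A : Set X} (h : IsBRESet μ T A) {a : ℕ → ℝ} (ha : Tendsto a atTop atTop)
    {b B c C : ℝ} (hc0 : 0 < c) (hcC : c ≤ C)
    (hbB : ∀ᵐ x ∂μ,
      lowerRate T (fun n => 2 * returnSeq μ T A n) (A.indicator (fun _ => (1 : ℝ))) x = b ∧
      upperRate T (fun n => 2 * returnSeq μ T A n) (A.indicator (fun _ => (1 : ℝ))) x = B)
    (hrate : ∀ᵐ x ∂μ, lowerRate T a (A.indicator (fun _ => (1 : ℝ))) x = c ∧
      upperRate T a (A.indicator (fun _ => (1 : ℝ))) x = C) :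
    c * μ.real A ≤ b * C ∧ B * c ≤ C * μ.real A ∧
      (fun n => 2 * returnSeq μ T A n) =Θ[atTop] a := by
  have hα := h.measureReal_pos
  have hC0 : 0 < C := hc0.trans_le hcC
  set α := μ.real A
  set s : ℕ → X → ℝ := symmSum T (A.indicator (fun _ => (1 : ℝ)))
  set d : ℕ → ℝ := fun n => 2 * returnSeq μ T A n
  have hd : Tendsto d atTop atTop := h.tendsto_two_mul_returnSeq hc hT
  have hlow : ∀ c' < c, ∀ᵐ x ∂μ, ∀ᶠ n in atTop, c' * (a n / d n) ≤ s n x / d n := by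
    intro c' hc'
    filter_upwards [hrate] with x hx
    have h1 : (c' : EReal) < lowerRate T a (A.indicator (fun _ => (1 : ℝ))) x := by
      rw [hx.1]; exact_mod_cast hc'
    filter_upwards [eventually_lt_of_lt_liminf h1, ha.eventually_gt_atTop 0,
      hd.eventually_gt_atTop 0] with n hn ha' hd'
    have h2 := (lt_div_iff₀ ha').1 (EReal.coe_lt_coe_iff.1 hn)
    rw [← mul_div_assoc]
    gcongr
  have hupp : ∀ C' > C, ∀ᵐ x ∂μ, ∀ᶠ n in atTop, s n x / d n ≤ C' * (a n / d n) := by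
    intro C' hC'
    filter_upwards [hrate] with x hx
    have h1 : upperRate T a (A.indicator (fun _ => (1 : ℝ))) x < (C' : EReal) := by
      rw [hx.2]; exact_mod_cast hC'
    filter_upwards [eventually_lt_of_limsup_lt h1, ha.eventually_gt_atTop 0,
      hd.eventually_gt_atTop 0] with n hn ha' hd'
    have h2 := (div_lt_iff₀ ha').1 (EReal.coe_lt_coe_iff.1 hn)
    rw [← mul_div_assoc]
    gcongr
  -- The bounds on `s n / d n` do not depend on the point, so the average bounds apply and confine
  -- `a n / d n` asymptotically to `[α / C, α / c]`.
  have hr1 : ∀ c' < c, ∀ y > α, ∀ᶠ n in atTop, c' * (a n / d n) ≤ y := fun c' hc' y hy =>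
    h.eventually_le_of_ae_eventually_le hc hT (hlow c' hc') hy
  have hr2 : ∀ C' > C, ∀ y < α, ∀ᶠ n in atTop, y ≤ C' * (a n / d n) := fun C' hC' y hy =>
    h.eventually_ge_of_ae_eventually_ge hc hT (hupp C' hC') hy
  have hne : NeBot (ae μ) := ae_neBot.2 fun h0 => by simpa [h0] using h.2.1
  have hsmall : ∀ᶠ ε : ℝ in 𝓝[>] 0, 0 < ε ∧ ε < c :=
    Ioo_mem_nhdsGT hc0
  have htend : ∀ g : ℝ → ℝ, Continuous g → Tendsto g (𝓝[>] 0) (𝓝 (g 0)) := fun g hg =>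
    (hg.tendsto 0).mono_left nhdsWithin_le_nhds
  refine ⟨?_, ?_, ?_⟩
  -- The bounds are available only for constants strictly beyond `c`, `C` and `α`, hence an `ε` in
  -- each, removed by continuity.
  · have hle : ∀ᶠ ε : ℝ in 𝓝[>] 0, (c - ε) * (α - ε) ≤ b * (C + ε) := by
      filter_upwards [hsmall] with ε ⟨hε, hεc⟩
      obtain ⟨x, hx1, hx2⟩ := ((hlow (c - ε) (by linarith)).and hbB).exists
      have h1 : (((c - ε) * (α - ε) / (C + ε) : ℝ) : EReal) ≤ b := by
        rw [← hx2.1]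
        refine le_liminf_of_le (by isBoundedDefault) ?_
        filter_upwards [hx1, hr2 (C + ε) (by linarith) (α - ε) (by linarith)] with n hn1 hn2
        refine EReal.coe_le_coe_iff.2 (le_trans ?_ hn1)
        rw [mul_div_assoc]
        refine mul_le_mul_of_nonneg_left ?_ (by linarith)
        rw [div_le_iff₀ (by linarith)]
        linarith
      exact (div_le_iff₀ (by linarith)).1 (EReal.coe_le_coe_iff.1 h1)
    have := le_of_tendsto_of_tendsto (htend (fun ε => (c - ε) * (α - ε)) (by fun_prop))
      (htend (fun ε => b * (C + ε)) (by fun_prop)) hle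
    simpa using this
  · have hle : ∀ᶠ ε : ℝ in 𝓝[>] 0, B * (c - ε) ≤ (C + ε) * (α + ε) := by
      filter_upwards [hsmall] with ε ⟨hε, hεc⟩
      obtain ⟨x, hx1, hx2⟩ := ((hupp (C + ε) (by linarith)).and hbB).exists
      have h1 : (B : EReal) ≤ (((C + ε) * (α + ε) / (c - ε) : ℝ) : EReal) := by
        rw [← hx2.2]
        refine limsup_le_of_le (by isBoundedDefault) ?_
        filter_upwards [hx1, hr1 (c - ε) (by linarith) (α + ε) (by linarith)] with n hn1 hn2
        refine EReal.coe_le_coe_iff.2 (le_trans hn1 ?_)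
        rw [mul_div_assoc]
        refine mul_le_mul_of_nonneg_left ?_ (by linarith)
        rw [le_div_iff₀ (by linarith)]
        linarith
      exact (le_div_iff₀ (by linarith)).1 (EReal.coe_le_coe_iff.1 h1)
    have := le_of_tendsto_of_tendsto (htend (fun ε => B * (c - ε)) (by fun_prop))
      (htend (fun ε => (C + ε) * (α + ε)) (by fun_prop)) hle
    simpa using this
  · constructor
    · refine IsBigO.of_bound (2 * (C + 1) / α) ?_
      filter_upwards [hr2 (C + 1) (by linarith) (α / 2) (by linarith), ha.eventually_gt_atTop 0,
        hd.eventually_gt_atTop 0] with n hn ha' hd'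
      rw [Real.norm_of_nonneg hd'.le, Real.norm_of_nonneg ha'.le]
      rw [← mul_div_assoc, le_div_iff₀ hd'] at hn
      rw [div_mul_eq_mul_div, le_div_iff₀ hα]
      linarith
    · refine IsBigO.of_bound (4 * α / c) ?_
      filter_upwards [hr1 (c / 2) (by linarith) (2 * α) (by linarith), ha.eventually_gt_atTop 0,
        hd.eventually_gt_atTop 0] with n hn ha' hd'
      rw [Real.norm_of_nonneg hd'.le, Real.norm_of_nonneg ha'.le]
      rw [← mul_div_assoc, div_le_iff₀ hd'] at hn
      rw [div_mul_eq_mul_div, le_div_iff₀ hc0]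
      linarith

end Rates

/-! ### The main theorem -/

theorem mainTheorem3 {X : Type*} [MeasurableSpace X] (μ : Measure X) [SigmaFinite μ]
    (T : X ≃ᵐ X) (hinf : μ Set.univ = ⊤) (hT : BoundedlyRationallyErgodic μ T) :
    -- the constants of `T` exist and are unique
    ((∀ β : ℝ, IsLowerBeta μ T β ↔ β = lowerBeta μ T) ∧ 0 ≤ lowerBeta μ T ∧ lowerBeta μ T ≤ 1) ∧
    ((∀ β : ℝ, IsUpperBeta μ T β ↔ β = upperBeta μ T) ∧ 1 ≤ upperBeta μ T) ∧
    -- the bound; division in `EReal` satisfies `c / ⊤ = 0`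
    ∀ a : ℕ → ℝ, Tendsto a atTop atTop →
      ∀ f : X → ℝ, Integrable f μ → 0 ≤ᵐ[μ] f →
        ∀ᵐ x ∂μ, 0 < lowerRate T a f x → lowerRate T a f x < ⊤ →
          lowerRate T a f x / upperRate T a f x ≤
              ((Real.sqrt (lowerBeta μ T / upperBeta μ T) : ℝ) : EReal) ∧
          -- if the limsup is finite, then `a_n` is comparable to `2 a_n(T)`
          (upperRate T a f x < ⊤ →
            ∀ A : Set X, IsBRESet μ T A →
              (fun n : ℕ => 2 * returnSeq μ T A n) =Θ[atTop] a) := by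
  obtain ⟨hc, hE, A, hA⟩ := hT
  have hα := hA.measureReal_pos
  obtain ⟨b, B, hb0, hbα, hBα, hbB⟩ := hA.exists_real_ae_rates_eq hc hE
  obtain ⟨hlow, hupp⟩ := hA.isLowerBeta_and_isUpperBeta hc hE hbB
  have hlow' : IsLowerBeta μ T (lowerBeta μ T) := Classical.epsilon_spec ⟨_, hlow⟩
  have hupp' : IsUpperBeta μ T (upperBeta μ T) := Classical.epsilon_spec ⟨_, hupp⟩
  have hlb : lowerBeta μ T = b / μ.real A := hA.isLowerBeta_unique hlow' hlow
  have hub : upperBeta μ T = B / μ.real A := hA.isUpperBeta_unique hupp' hupp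
  refine ⟨⟨fun β => ⟨fun h => hA.isLowerBeta_unique h hlow', fun h => h ▸ hlow'⟩, ?_, ?_⟩,
    ⟨fun β => ⟨fun h => hA.isUpperBeta_unique h hupp', fun h => h ▸ hupp'⟩, ?_⟩, ?_⟩
  · rw [hlb]; positivity
  · rwa [hlb, div_le_one hα]
  · rwa [hub, one_le_div hα]
  · intro a ha f hi hf
    obtain ⟨c, C, hcC⟩ := exists_ae_rates_indicator_eq hc hE hA.1 hA.2.1 ha
    rcases (integral_nonneg_of_ae hf).eq_or_lt' with h0 | h0
    · filter_upwards [ae_rates_eq_zero hE.toMeasurePreserving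
        ((integral_eq_zero_iff_of_nonneg_ae hf hi).1 h0)] with x hx hpos
      exact absurd (hx a).1 hpos.ne'
    have haa : Tendsto (fun n => a n / a n) atTop (𝓝 1) :=
      tendsto_const_nhds.congr' ((ha.eventually_gt_atTop 0).mono fun n hn => (div_self hn.ne').symm)
    filter_upwards [ae_rates_eq_mul hc hE hA.1 hA.2.1 hA.2.2.1 hi h0, hcC] with x hx hx' hpos hfin
    obtain ⟨h1, h2⟩ := hx a a ha haa
    have hL : 0 < (∫ y, f y ∂μ) / μ.real A := div_pos h0 hα
    have hcleC : c ≤ C := by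
      rw [← hx'.1, ← hx'.2]
      exact liminf_le_limsup
    rw [hx'.1] at h1
    rw [hx'.2] at h2
    rw [h1] at hpos hfin ⊢
    rw [h2]
    set L := (∫ y, f y ∂μ) / μ.real A
    induction c with
    | bot => rw [EReal.coe_mul_bot_of_pos hL] at hpos; exact absurd hpos not_lt_bot
    | top => rw [EReal.coe_mul_top_of_pos hL] at hfin; exact absurd hfin (lt_irrefl _)
    | coe c =>
      rw [← EReal.coe_mul, EReal.coe_pos] at hpos
      have hc0 : 0 < c := (pos_iff_pos_of_mul_pos hpos).1 hL
      induction C with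
      | bot => exact absurd hcleC (not_le.2 (EReal.bot_lt_coe c))
      | top =>
        rw [EReal.coe_mul_top_of_pos hL, EReal.div_top]
        -- With infinite limsup the quotient is `0` and the comparability claim is vacuous.
        exact ⟨EReal.coe_nonneg.2 (Real.sqrt_nonneg _), fun h => absurd h (lt_irrefl _)⟩
      | coe C =>
        have hcC' : c ≤ C := EReal.coe_le_coe_iff.1 hcleC
        have hC0 : 0 < C := hc0.trans_le hcC'
        obtain ⟨k1, k2, k3⟩ := hA.rates_le_and_isTheta hc hE ha hc0 hcC' hbB hcC
        refine ⟨?_, fun _ A' hA' => ?_⟩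
        · rw [← EReal.coe_mul, ← EReal.coe_mul, ← EReal.coe_div, EReal.coe_le_coe_iff,
            mul_div_mul_left _ _ hL.ne', hlb, hub, div_div_div_cancel_right₀ hα.ne']
          have hB0 : 0 < B := hα.trans_le hBα
          refine Real.le_sqrt_of_sq_le ?_
          rw [div_pow, div_le_div_iff₀ (by positivity) hB0]
          -- The two bounds chain as `c (B c) ≤ c (C α) = C (c α) ≤ C (b C)`, with `α = μ(A)`.
          nlinarith [mul_le_mul_of_nonneg_left k2 hc0.le, mul_le_mul_of_nonneg_left k1 hC0.le]
        -- Comparability is known for the fixed set `A` and passes to any `A'` because their return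
        -- sequences are asymptotic.
        · refine IsEquivalent.isTheta ?_ |>.trans k3
          refine (isEquivalent_iff_tendsto_one ?_).2 (hA.tendsto_returnSeq_div hc hE hA')
          exact ((hA.tendsto_two_mul_returnSeq hc hE).eventually_gt_atTop 0).mono fun n hn => hn.ne'
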